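/- Let $V,V'$ be real vector spaces in perfect duality and let $\Phi\subset V$ be a finite crystallographic root system (with coroots in $V'$), not necessarily reduced and not necessarily spanning $V$. Let $W$ be its Weyl group, $\Delta$ a set of simple roots, $\Phi^+$ the corresponding positive roots, and let $\theta\subseteq\Delta$. (Guiding case: $G$ is a connected reductive group over a non-archimedean local field of characteristic $0$, $T$ a minimal Levi subgroup, $V=\mathfrak a_T^*$, $\Phi$ the root system of $G$ with respect to $T$, and $\theta$ the set of simple roots of a standard Levi subgroup $M$. The notation below follows this case.) For a subspace $S\subseteq V$ let $W^S$ be the subgroup of $W$ generated by the reflections in $\Phi\cap S$, and let $w_0^S$ be its longest element with respect to the positive roots $\Phi^+\cap S$. Put * $S_M=\operatorname{span}_{\mathbb R}\theta$, $\Phi^M=\Phi\cap S_M$, $W^M=W^{S_M}$, $\mathfrak a_M^*=V/S_M$; write $w.M=M$ if $w\Phi^M=\Phi^M$; * $W_M=\{w\in W: w.M=M\}/W^M$, the relative Weyl group, which acts on $\mathfrak a_M^*$; * $\Phi_M$, the set of reduced relative roots: the nonzero images in $\mathfrak a_M^*$ of the roots in $\Phi$ that are not of the form $n\gamma$ with $n\ge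 2$ an integer and $\gamma$ another such image; a relative root is positive ($>0$) if it is the image of a positive root; * for $\alpha\in\Phi_M$, the relative reflection $w_\alpha=w_0^{M_\alpha}w_0^M\in W$, where $w_0^M=w_0^{S_M}$ and $w_0^{M_\alpha}=w_0^{S_\alpha}$ with $S_\alpha$ the preimage of $\mathbb R\alpha$ in $V$ (so $\Phi\cap S_\alpha$ is the root system of the co-rank one Levi subgroup $M_\alpha\supseteq M$); * $\Phi_M^0=\{\alpha\in\Phi_M: w_\alpha.M=M\}$ and $(\Phi_M^0)^+=\{\alpha\in\Phi_M^0:\alpha>0\}$; * $W_M^0=\langle w_\alpha:\alpha\in\Phi_M^0\rangle\subseteq W_M$ and $W_M^1=\{w\in W_M: w.(\Phi_M^0)^+>0\}$. Then $W_M^1$ is a subgroup of $W_M$, equal to the stabilizer of the set $(\Phi_M^0)^+$; the subgroup $W_M^0$ is normal in $W_M$; and $$W_M=W_M^0\rtimes W_M^1 .$$ Moreover $\Phi_M^0$ is a relative subroot system (possibly empty or reducible): it is a finite reduced crystallographic root system in the subspace of $\mathfrak a_M^*$ that it spans, and for every $\alpha\in\Phi_M^0$ the class of $w_\alpha$ in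 $W_M$ acts on $\mathfrak a_M^*$ as the reflection in $\alpha$ of this root system. -/

import Mathlib

open scoped Pointwise

noncomputable section

namespace RelativeWeyl

variable {ι V V' : Type*} [AddCommGroup V] [Module ℝ V] [AddCommGroup V'] [Module ℝ V']

/-- A set of simple roots of a (not necessarily reduced, not necessarily spanning) root pairing:
a linearly independent set of roots such that every root is, up to sign, a sum of simple roots.
For non-reduced root pairings the structure `RootPairing.Base` of Mathlib would be too
restrictive, since it also constrains the coroots. -/
structure SimpleRoots (P : RootPairing ι ℝ V V') where
  support : Set ι
  linearIndepOn_root : LinearIndepOn ℝ P.root support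
  root_mem_or_neg_mem (i : ι) : P.root i ∈ AddSubmonoid.closure (P.root '' support) ∨
    -P.root i ∈ AddSubmonoid.closure (P.root '' support)

/-- The root `i` is positive: it is a sum of simple roots. -/
def SimpleRoots.IsPos {P : RootPairing ι ℝ V V'} (Δ : SimpleRoots P) (i : ι) : Prop :=
  P.root i ∈ AddSubmonoid.closure (P.root '' Δ.support)

variable (P : RootPairing ι ℝ V V') (Δ : SimpleRoots P) (θ : Set ι)

/-! ### Levi subgroups

A semistandard Levi subgroup is the centralizer of a subtorus of the maximal split torus, and it is
recorded by the subspace `S` of `V` of all characters that are trivial on the subtorus: its roots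
are the roots in `S`. -/

/-- The roots of the semistandard Levi subgroup `L` attached to the subspace `S`. -/
def leviRoots (S : Submodule ℝ V) : Set ι := {i | P.root i ∈ S}

/-- The Weyl group `W^L` of `L`, generated by the reflections in the roots of `L`. -/
def leviWeyl (S : Submodule ℝ V) : Subgroup P.weylGroup :=
  Subgroup.closure (RootPairing.weylGroup.ofIdx P '' leviRoots P S)

variable {P} in
/-- The length of `w` as an element of the Weyl group of `L`: the number of reduced positive roots
of `L` which `w` makes negative. -/
def leviLength (S : Submodule ℝ V) (w : P.weylGroup) : ℕ :=
  Set.ncard {i ∈ leviRoots P S |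
    (∀ j, P.root i ≠ (2 : ℝ) • P.root j) ∧ Δ.IsPos i ∧ ¬ Δ.IsPos (w • i)}

variable {P} in
/-- `w` is an element of maximal length of `W^L`. -/
def IsLongest (S : Submodule ℝ V) (w : P.weylGroup) : Prop :=
  w ∈ leviWeyl P S ∧ ∀ u ∈ leviWeyl P S, leviLength Δ S u ≤ leviLength Δ S w

variable {P} in
theorem exists_isLongest [Finite ι] (S : Submodule ℝ V) :
    ∃ w : P.weylGroup, IsLongest Δ S w := by
  let A : Set ℕ := leviLength Δ S '' (leviWeyl P S : Set P.weylGroup)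
  have hne : A.Nonempty := ⟨_, 1, one_mem _, rfl⟩
  have hb : BddAbove A := by
    refine ⟨Nat.card ι, ?_⟩
    rintro _ ⟨w, -, rfl⟩
    exact Set.ncard_le_card _
  obtain ⟨w, hw, hwA⟩ := Nat.sSup_mem hne hb
  exact ⟨w, hw, fun u hu ↦ hwA ▸ le_csSup hb ⟨u, hu, rfl⟩⟩

variable {P} in
/-- The longest element `w_0^L` of the Weyl group `W^L`. -/
def longest [Finite ι] (S : Submodule ℝ V) : P.weylGroup :=
  (exists_isLongest Δ S).choose

/-! ### The standard Levi subgroup `M` attached to a set `θ` of simple roots -/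

/-- The subspace attached to the standard Levi subgroup `M`, spanned by the roots in `θ`. -/
def leviSpan : Submodule ℝ V := Submodule.span ℝ (P.root '' θ)

/-- The space `𝔞_M^*`, the quotient of `𝔞_T^* = V` obtained by restricting characters to the
maximal split torus in the centre of `M`. -/
abbrev RelSpace : Type _ := V ⧸ leviSpan P θ

/-- The group `{w ∈ W : w.M = M}`. -/
def leviStabilizer : Subgroup P.weylGroup :=
  MulAction.stabilizer P.weylGroup (leviRoots P (leviSpan P θ))

variable {P θ} in
theorem mem_leviStabilizer {w : P.weylGroup} (hw : w ∈ leviStabilizer P θ) (i : ι) :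
    P.root (w • i) ∈ leviSpan P θ ↔ P.root i ∈ leviSpan P θ := by
  have h : w • leviRoots P (leviSpan P θ) = leviRoots P (leviSpan P θ) := hw
  have h2 : w • i ∈ w • leviRoots P (leviSpan P θ) ↔ i ∈ leviRoots P (leviSpan P θ) :=
    Set.smul_mem_smul_set_iff
  rw [h] at h2
  exact h2

theorem root_smul (w : P.weylGroup) (i : ι) : P.root (w • i) = w • P.root i :=
  (P.weylGroup_apply_root w i).symm

theorem conj_ofIdx (w : P.weylGroup) (i : ι) :
    w * RootPairing.weylGroup.ofIdx P i * w⁻¹ = RootPairing.weylGroup.ofIdx P (w • i) := by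
  rw [mul_inv_eq_iff_eq_mul]
  apply Subtype.ext
  apply RootPairing.Equiv.weightHom_injective P
  refine LinearEquiv.ext fun x ↦ ?_
  have hco : P.coroot' (w • i) (w • x) = P.coroot' i x := by
    have h1 := RootPairing.Hom.coroot_coweightMap_apply P P (w • i) (w : P.Aut).toHom
    have h2 := LinearMap.congr_fun (RootPairing.Hom.weight_coweight_transpose_apply P P
      (P.coroot (w • i)) (w : P.Aut).toHom) x
    rw [h1] at h2
    have h3 : (w : P.Aut).toHom.indexEquiv.symm (w • i) = i :=
      (w : P.Aut).toHom.indexEquiv.symm_apply_apply i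
    rw [h3] at h2
    exact h2
  change w • P.reflection i x = P.reflection (w • i) (w • x)
  rw [P.reflection_apply, P.reflection_apply, hco, root_smul, smul_sub, smul_comm]

/-- `W^M` is normal in `{w ∈ W : w.M = M}`. -/
instance leviWeyl_normal :
    ((leviWeyl P (leviSpan P θ)).subgroupOf (leviStabilizer P θ)).Normal := by
  refine ⟨fun n hn g ↦ ?_⟩
  rw [Subgroup.mem_subgroupOf] at hn ⊢
  have key : leviWeyl P (leviSpan P θ) ≤
      (leviWeyl P (leviSpan P θ)).comap (MulAut.conj (g : P.weylGroup)).toMonoidHom := by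
    conv_lhs => rw [leviWeyl]
    rw [Subgroup.closure_le]
    rintro _ ⟨i, hi, rfl⟩
    change (g : P.weylGroup) * RootPairing.weylGroup.ofIdx P i * (g : P.weylGroup)⁻¹ ∈
      leviWeyl P (leviSpan P θ)
    rw [conj_ofIdx]
    exact Subgroup.subset_closure ⟨_, (mem_leviStabilizer g.2 i).2 hi, rfl⟩
  exact key hn

/-- The relative Weyl group `W_M = {w ∈ W : w.M = M} / W^M`. -/
abbrev RelWeylGroup : Type _ :=
  leviStabilizer P θ ⧸ (leviWeyl P (leviSpan P θ)).subgroupOf (leviStabilizer P θ)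

theorem leviSpan_le_comap (w : leviStabilizer P θ) :
    leviSpan P θ ≤ (leviSpan P θ).comap (P.weylGroupRootRep (w : P.weylGroup)) := by
  rw [leviSpan, Submodule.span_le]
  rintro _ ⟨i, hi, rfl⟩
  have := (mem_leviStabilizer w.2 i).2 (Submodule.subset_span ⟨i, hi, rfl⟩)
  rw [root_smul] at this
  exact this

/-- The action of `{w ∈ W : w.M = M}` on `𝔞_M^*`. -/
def stabilizerRep : leviStabilizer P θ →* Module.End ℝ (RelSpace P θ) where
  toFun w := Submodule.mapQ _ _ (P.weylGroupRootRep (w : P.weylGroup)) (leviSpan_le_comap P θ w)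
  map_one' := by
    ext x
    simp
  map_mul' u w := by
    ext x
    simp

variable {P θ} in
theorem reflection_sub_mem (i : ι) (hi : i ∈ leviRoots P (leviSpan P θ)) (x : V) :
    RootPairing.weylGroup.ofIdx P i • x - x ∈ leviSpan P θ := by
  change P.reflection i x - x ∈ _
  rw [P.reflection_apply, sub_sub_cancel_left, neg_mem_iff]
  exact Submodule.smul_mem _ _ hi

theorem stabilizerRep_eq_one (w : leviStabilizer P θ)
    (hw : w ∈ (leviWeyl P (leviSpan P θ)).subgroupOf (leviStabilizer P θ)) :
    stabilizerRep P θ w = 1 := by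
  rw [Subgroup.mem_subgroupOf] at hw
  have key : ∀ u ∈ leviWeyl P (leviSpan P θ), ∀ x : V, u • x - x ∈ leviSpan P θ := by
    intro u hu
    induction hu using Subgroup.closure_induction'' with
    | one => simp
    | mem u hu =>
      obtain ⟨i, hi, rfl⟩ := hu
      exact reflection_sub_mem i hi
    | inv_mem u hu =>
      obtain ⟨i, hi, rfl⟩ := hu
      have h : (RootPairing.weylGroup.ofIdx P i)⁻¹ = RootPairing.weylGroup.ofIdx P i :=
        Subtype.ext (RootPairing.Equiv.reflection_inv P i)
      rw [h]
      exact reflection_sub_mem i hi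
    | mul u v _ _ hu hv =>
      intro x
      have := add_mem (hu (v • x)) (hv x)
      rwa [sub_add_sub_cancel, smul_smul] at this
  ext x
  exact (Submodule.Quotient.eq _).2 (key _ hw x)

/-- The action of the relative Weyl group `W_M` on `𝔞_M^*`. -/
def relRep : RelWeylGroup P θ →* Module.End ℝ (RelSpace P θ) :=
  QuotientGroup.lift _ (stabilizerRep P θ) (stabilizerRep_eq_one P θ)

/-- The relative roots of `M`: the nonzero restrictions of roots. -/
def relRoots : Set (RelSpace P θ) :=
  {β | β ≠ 0 ∧ ∃ i, (leviSpan P θ).mkQ (P.root i) = β}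

/-- The set `Φ_M` of reduced relative roots: those that are not a proper multiple of another
relative root. -/
def reducedRelRoots : Set (RelSpace P θ) :=
  {β ∈ relRoots P θ | ∀ γ ∈ relRoots P θ, ∀ n : ℕ, 2 ≤ n → β ≠ n • γ}

variable {P} in
/-- A relative root is positive if it is the restriction of a positive root, that is, if it occurs
in the unipotent radical of the standard parabolic subgroup with Levi subgroup `M`. -/
def IsRelPos (β : RelSpace P θ) : Prop :=
  β ≠ 0 ∧ ∃ i, Δ.IsPos i ∧ (leviSpan P θ).mkQ (P.root i) = β

variable {P θ} in
/-- The subspace attached to the co-rank one Levi subgroup `M_β ⊇ M` of a relative root `β`: the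
roots of `M_β` are the roots whose restriction is a multiple of `β`. -/
def corankOneSpan (β : RelSpace P θ) : Submodule ℝ V :=
  (Submodule.span ℝ {β}).comap (leviSpan P θ).mkQ

variable {P θ} in
/-- The relative reflection `w_β = w_0^{M_β} w_0^M`, an element of `W`. -/
def relReflection [Finite ι] (β : RelSpace P θ) : P.weylGroup :=
  longest Δ (corankOneSpan β) * longest Δ (leviSpan P θ)

variable {P} in
/-- The set `Φ_M^0` of reduced relative roots `β` with `w_β.M = M`. -/
def relRootsZero [Finite ι] : Set (RelSpace P θ) :=
  {β ∈ reducedRelRoots P θ | relReflection Δ β ∈ leviStabilizer P θ}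

variable {P θ} in
/-- The class in `W_M` of the relative reflection `w_β`, for `β ∈ Φ_M^0`. -/
def relReflectionClass [Finite ι] (β : relRootsZero Δ θ) : RelWeylGroup P θ :=
  QuotientGroup.mk ⟨relReflection Δ β.1, β.2.2⟩

variable {P} in
/-- The set `(Φ_M^0)^+` of positive elements of `Φ_M^0`. -/
def relRootsZeroPos [Finite ι] : Set (RelSpace P θ) :=
  {β ∈ relRootsZero Δ θ | IsRelPos Δ θ β}

variable {P} in
/-- The small relative Weyl group `W_M^0`, generated by the `w_β` with `β ∈ Φ_M^0`. -/
def relWeylZero [Finite ι] : Subgroup (RelWeylGroup P θ) :=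
  Subgroup.closure (Set.range (relReflectionClass Δ (θ := θ)))

variable {P} in
/-- The set `W_M^1 = {w ∈ W_M : w.(Φ_M^0)^+ > 0}`. -/
def relWeylOne [Finite ι] : Set (RelWeylGroup P θ) :=
  {w | ∀ β ∈ relRootsZeroPos Δ θ, IsRelPos Δ θ (relRep P θ w β)}

end RelativeWeyl

end

/-!
Whether a root outside `S_M` is positive depends only on its image in `𝔞_M^*`. An element of the
stabilizer of `M` can be corrected by an element of `W^M` so that it preserves the positive roots
in `S_M`, and an element of a Weyl group that preserves positivity is trivial. Hence `W_M` acts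
faithfully on `𝔞_M^*`, and, in the same way, `w_β` is up to `W^M` the only element of `W^{M_β}`
that stabilizes `M` and sends `β` to `-β`. So `Φ_M^0` consists of the reduced relative roots for
which there is such an element, a condition that is invariant under `W_M`.

Exactly one simple root of `M_β` lies outside `S_M`, so the images of the roots of `M_β` are the
integral multiples of a single relative root. Therefore `w_β` moves every relative root by an
integral multiple of `β`, and proportional reduced relative roots agree up to sign. For a
`W_M`-invariant inner product on `𝔞_M^*` the `w_β` are orthogonal reflections, so `Φ_M^0` is a
reduced crystallographic root system, permuted by `W_M`, whose Weyl group is `W_M^0`.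

The rest holds for every finite group of linear maps that permutes a root system and contains its
reflections. The inner product turns a functional `l` that defines the positive roots into a vector
`x`. If `μ (h x)` is maximal among the `h` in the Weyl group, then `μ ∘ h` is nonnegative on the
positive roots; for `μ = l ∘ g⁻¹` this makes `g⁻¹ h` preserve positivity. Thus every `g` is a
product of an element of the Weyl group and one preserving the positive roots, and the
factorization is unique because only the identity of the Weyl group preserves the positive roots.
-/

noncomputable section

namespace RelativeWeyl

open Module

section BilinearForm

variable {R M : Type*} [CommRing R] [AddCommGroup M] [Module R M] {B : M →ₗ[R] M →ₗ[R] R}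
  {s : M →ₗ[R] M}

theorem nondegenerate_of_pos [Preorder R] (hB : ∀ x, x ≠ 0 → 0 < B x x) :
    B.Nondegenerate :=
  ⟨fun x h ↦ by_contra fun hx ↦ (hB x hx).ne' (h x),
    fun x h ↦ by_contra fun hx ↦ (hB x hx).ne' (h x)⟩

theorem mul_apply_self_eq_two_mul_of_isOrthogonal (hs : B.IsOrthogonal s) {a y : M}
    (ha : s a = -a) {c : R} (hy : s y = y - c • a) : c * B a a = 2 * B y a := by
  have h := hs y a
  simp only [ha, hy, map_neg, map_sub, map_smul, LinearMap.sub_apply, LinearMap.smul_apply,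
    smul_eq_mul] at h
  linear_combination h

theorem eq_reflection_of_isOrthogonal (hB : B.IsSymm) (hs : B.IsOrthogonal s) {a y : M}
    (ha : B.IsReflective a) (hsa : s a = -a) {c : R} (hy : s y = y - c • a) :
    s y = Module.reflection (LinearMap.IsReflective.coroot_apply_self B ha) y := by
  have hc : B a a * c = B a a * LinearMap.IsReflective.coroot B ha y := by
    rw [LinearMap.IsReflective.apply_self_mul_coroot_apply, mul_comm,
      mul_apply_self_eq_two_mul_of_isOrthogonal hs hsa hy, ← hB.eq a y, RingHom.id_apply]
  rw [hy, Module.reflection_apply, ha.regular.left hc]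

end BilinearForm

section FiniteGroup

variable {K E G : Type*} [Field K] [LinearOrder K] [IsStrictOrderedRing K]
  [AddCommGroup E] [Module K E] [FiniteDimensional K E] [Group G] [Finite G]

theorem exists_isSymm_pos_isOrthogonal (ρ : Representation K G E) :
    ∃ B : E →ₗ[K] E →ₗ[K] K, B.IsSymm ∧ (∀ x, x ≠ 0 → 0 < B x x) ∧
      ∀ g, B.IsOrthogonal (ρ g) := by
  have := Fintype.ofFinite G
  let b := finBasis K E
  let B : E →ₗ[K] E →ₗ[K] K := ∑ g : G, ∑ i,
    (b.coord i ∘ₗ ρ g).smulRight (b.coord i ∘ₗ ρ g)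
  have hB (x y : E) : B x y = ∑ g : G, ∑ i, b.repr (ρ g x) i * b.repr (ρ g y) i := by
    simp [B, LinearMap.sum_apply]
  refine ⟨B, ⟨fun x y ↦ ?_⟩, fun x hx ↦ ?_, fun g x y ↦ ?_⟩
  · simp only [hB, mul_comm, RingHom.id_apply]
  · obtain ⟨i, hi⟩ : ∃ i, b.repr x i ≠ 0 := by
      by_contra! h
      exact hx (b.ext_elem fun i ↦ by simp [h i])
    rw [hB]
    refine Finset.sum_pos' (fun g _ ↦ Finset.sum_nonneg fun i _ ↦ mul_self_nonneg _)
      ⟨1, Finset.mem_univ 1, Finset.sum_pos' (fun i _ ↦ mul_self_nonneg _)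
        ⟨i, Finset.mem_univ i, ?_⟩⟩
    simpa using mul_self_pos.2 hi
  · simp only [hB, ← End.mul_apply, ← map_mul]
    exact Fintype.sum_equiv (Equiv.mulRight g) _ _ fun h ↦ rfl

theorem exists_mem_forall_nonneg (ρ : Representation K G E) (H : Subgroup G) (A : Set E)
    (hA : ∀ a ∈ A, ∃ s ∈ H, ∃ f : Dual K E, f a = 2 ∧ ∀ x, ρ s x = x - f x • a)
    (l μ : Dual K E) : ∃ h ∈ H, ∀ a ∈ A, 0 < l a → 0 ≤ μ (ρ h a) := by
  obtain ⟨B, -, hpos, hinv⟩ := exists_isSymm_pos_isOrthogonal ρ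
  have hnd := nondegenerate_of_pos hpos
  let x := (LinearMap.BilinForm.toDual B hnd).symm l
  have hx (y : E) : B x y = l y := LinearMap.BilinForm.apply_toDual_symm_apply (hB := hnd) l y
  obtain ⟨h, hmax⟩ := Finite.exists_max fun h : H ↦ μ (ρ h x)
  refine ⟨h, h.2, fun a ha hla ↦ ?_⟩
  obtain ⟨s, hsH, f, hfa, hf⟩ := hA a ha
  have ha0 : a ≠ 0 := by rintro rfl; simp at hla
  have hsa : ρ s a = -a := by rw [hf, hfa, two_smul]; abel
  have hfx : 0 < f x := by
    refine pos_of_mul_pos_left ?_ (hpos a ha0).le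
    rw [mul_apply_self_eq_two_mul_of_isOrthogonal (hinv s) hsa (hf x), hx]
    positivity
  have hle : μ (ρ h (ρ s x)) ≤ μ (ρ h x) := by simpa using hmax (h * ⟨s, hsH⟩)
  simp only [hf, map_sub, map_smul, smul_eq_mul, sub_le_self_iff] at hle
  exact nonneg_of_mul_nonneg_right hle hfx

end FiniteGroup

section Cone

variable {K E : Type*} [CommRing K] [PartialOrder K] [IsOrderedRing K] [AddCommGroup E]
  [Module K E] {f : Dual K E} {s : Set E} {x : E}

theorem nonneg_of_mem_closure (hf : ∀ y ∈ s, 0 ≤ f y) (hx : x ∈ AddSubmonoid.closure s) :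
    0 ≤ f x := by
  induction hx using AddSubmonoid.closure_induction with
  | mem y hy => exact hf y hy
  | zero => rw [map_zero]
  | add y z _ _ hy hz => rw [map_add]; exact add_nonneg hy hz

theorem mem_span_of_mem_closure_of_apply_eq_zero (hf : ∀ y ∈ s, 0 ≤ f y)
    (hx : x ∈ AddSubmonoid.closure s) (h0 : f x = 0) :
    x ∈ Submodule.span K (s ∩ LinearMap.ker f) := by
  induction hx using AddSubmonoid.closure_induction with
  | mem y hy => exact Submodule.subset_span ⟨hy, h0⟩
  | zero => exact zero_mem _
  | add y z hy hz ihy ihz =>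
    rw [map_add, add_eq_zero_iff_of_nonneg (nonneg_of_mem_closure hf hy)
      (nonneg_of_mem_closure hf hz)] at h0
    exact add_mem (ihy h0.1) (ihz h0.2)

end Cone

theorem exists_dual_apply_eq {K E κ : Type*} [Field K] [AddCommGroup E] [Module K E] {v : κ → E}
    {s : Set κ} (hv : LinearIndepOn K v s) (c : κ → K) :
    ∃ f : Dual K E, ∀ i ∈ s, f (v i) = c i := by
  have hli : LinearIndependent K fun i : s ↦ v i := hv
  obtain ⟨f, hf⟩ := ((Basis.span hli).constr K fun i : s ↦ c i).exists_extend
  refine ⟨f, fun i hi ↦ ?_⟩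
  have h := LinearMap.congr_fun hf (Basis.span hli ⟨i, hi⟩)
  rwa [Basis.constr_basis, LinearMap.comp_apply, Submodule.subtype_apply, Basis.span_apply] at h

section WeylGroup

open RootPairing.weylGroup (ofIdx)

variable {ι V V' : Type*} [AddCommGroup V] [Module ℝ V] [AddCommGroup V'] [Module ℝ V']
  {Q : RootPairing ι ℝ V V'}

theorem ofIdx_inv (i : ι) : (ofIdx Q i)⁻¹ = ofIdx Q i :=
  Subtype.ext (RootPairing.Equiv.reflection_inv Q i)

theorem ofIdx_smul (i : ι) (x : V) : ofIdx Q i • x = x - Q.coroot' i x • Q.root i :=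
  Q.reflection_apply i x

theorem root_ofIdx_smul_self (i : ι) : Q.root (ofIdx Q i • i) = -Q.root i := by
  rw [root_smul]
  exact Q.reflection_apply_self i

variable (Q) in
theorem closure_range_ofIdx : Subgroup.closure (Set.range (ofIdx Q)) = ⊤ := by
  refine Eq.trans ?_ (Subgroup.closure_closure_coe_preimage
    (k := Set.range (RootPairing.Equiv.reflection Q)))
  congr 1
  ext w
  exact ⟨fun ⟨i, hi⟩ ↦ ⟨i, congrArg Subtype.val hi⟩, fun ⟨i, hi⟩ ↦ ⟨i, Subtype.ext hi⟩⟩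

variable (Q) in
theorem leviWeyl_top : leviWeyl Q ⊤ = ⊤ := by
  rw [leviWeyl, ← closure_range_ofIdx Q]
  simp [leviRoots]

theorem smul_sub_mem {S : Submodule ℝ V} {w : Q.weylGroup} (hw : w ∈ leviWeyl Q S) (x : V) :
    w • x - x ∈ S := by
  induction hw using Subgroup.closure_induction'' generalizing x with
  | one => simp
  | mem w hw | inv_mem w hw =>
    obtain ⟨i, hi, rfl⟩ := hw
    simp only [ofIdx_inv, ofIdx_smul, sub_sub_cancel_left, neg_mem_iff]
    exact S.smul_mem _ hi
  | mul u w _ _ hu hw => simpa [smul_smul] using add_mem (hu (w • x)) (hw x)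

theorem coroot'_smul_smul (w : Q.weylGroup) (i : ι) (x : V) :
    Q.coroot' (w • i) (w • x) = Q.coroot' i x := by
  have h : ofIdx Q (w • i) • w • x = w • ofIdx Q i • x := by
    rw [← conj_ofIdx, smul_smul, inv_mul_cancel_right, mul_smul]
  rw [ofIdx_smul, ofIdx_smul, smul_sub, smul_comm, ← root_smul] at h
  exact smul_left_injective ℝ (Q.ne_zero (w • i)) (sub_right_injective h)

theorem weylGroupToPerm_injective [Finite ι] : Function.Injective Q.weylGroupToPerm := by
  have := Fintype.ofFinite ι
  refine (injective_iff_map_eq_one _).2 fun w hw ↦ ?_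
  have hfix (i : ι) : w • i = i := DFunLike.congr_fun hw i
  refine Subtype.ext (RootPairing.Equiv.weightHom_injective Q (LinearEquiv.ext fun x ↦ ?_))
  refine sub_eq_zero.1 (Submodule.disjoint_def.1 Q.disjoint_rootSpan_ker_rootForm (w • x - x)
    (smul_sub_mem ?_ x) (LinearMap.ext fun y ↦ ?_))
  · have hle : leviWeyl Q ⊤ ≤ leviWeyl Q (Q.rootSpan ℝ) := Subgroup.closure_mono
      (Set.image_mono fun i _ ↦ Submodule.subset_span (M := V) (Set.mem_range_self i))
    exact hle (leviWeyl_top Q ▸ Subgroup.mem_top w)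
  · have hcoroot (i : ι) : Q.coroot' i (w • x - x) = 0 := by
      rw [map_sub, sub_eq_zero, ← coroot'_smul_smul w i x, hfix]
    simp only [Q.rootForm_apply_apply, hcoroot, zero_mul, Finset.sum_const_zero,
      LinearMap.zero_apply]

instance finite_weylGroup [Finite ι] : Finite Q.weylGroup :=
  Finite.of_injective _ weylGroupToPerm_injective

theorem ofIdx_eq_of_root_mem_span [Finite ι] {i j : ι}
    (h : Q.root j ∈ Submodule.span ℝ {Q.root i}) :
    ofIdx Q j = ofIdx Q i := by
  have : IsAddTorsionFree V' := .of_isTorsionFree ℝ V'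
  obtain ⟨c, hc⟩ := Submodule.mem_span_singleton.1 h
  have hcoroot := Q.smul_coroot_eq_of_root_eq_smul i j c hc.symm
  refine Subtype.ext (RootPairing.Equiv.weightHom_injective Q (LinearEquiv.ext fun x ↦ ?_))
  change ofIdx Q j • x = ofIdx Q i • x
  rw [ofIdx_smul, ofIdx_smul, ← hc, smul_smul, RootPairing.coroot', RootPairing.coroot',
    ← hcoroot, map_smul, LinearMap.smul_apply, smul_eq_mul, mul_comm c]

end WeylGroup

section Simples

open RootPairing.weylGroup (ofIdx)

variable {ι V V' : Type*} [AddCommGroup V] [Module ℝ V] [AddCommGroup V'] [Module ℝ V']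

/-- The indecomposable roots among those at which `l` is positive: the simple roots of the positive
system defined by `l`, when `l` vanishes at no root. -/
def simples (Q : RootPairing ι ℝ V V') (l : Dual ℝ V) : Set ι :=
  IsAddIndecomposable.baseOf Q.root (l : V →+ ℝ)

variable {Q : RootPairing ι ℝ V V'} {l : Dual ℝ V} {i j : ι}

theorem pos_of_mem_simples (hi : i ∈ simples Q l) : 0 < l (Q.root i) :=
  IsAddIndecomposable.baseOf_subset_pos _ _ hi

variable [Finite ι]

theorem root_mem_closure_simples (hi : 0 < l (Q.root i)) :
    Q.root i ∈ AddSubmonoid.closure (Q.root '' simples Q l) := by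
  have h := AddSubmonoid.closure_image_isAddIndecomposable_baseOf Q.root (l : V →+ ℝ)
  rw [simples, h]
  exact AddSubmonoid.subset_closure ⟨i, hi, rfl⟩

theorem root_mem_of_forall_simples (hl : ∀ i, l (Q.root i) ≠ 0) {A : AddSubgroup V}
    (hA : ∀ j ∈ simples Q l, Q.root j ∈ A) (i : ι) : Q.root i ∈ A := by
  have hle : AddSubmonoid.closure (Q.root '' simples Q l) ≤ A.toAddSubmonoid :=
    AddSubmonoid.closure_le.2 (Set.image_subset_iff.2 hA)
  rcases (hl i).lt_or_gt with hi | hi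
  · obtain ⟨j, hj⟩ := Q.neg_root_mem i
    rw [← neg_mem_iff, ← hj]
    exact hle (root_mem_closure_simples (by rwa [hj, map_neg, neg_pos]))
  · exact hle (root_mem_closure_simples hi)

variable [Q.IsCrystallographic]

theorem pos_ofIdx_smul (hl : ∀ i, l (Q.root i) ≠ 0) (hi : i ∈ simples Q l)
    (hj : 0 < l (Q.root j)) (hij : Q.root j ∉ Submodule.span ℝ {Q.root i}) :
    0 < l (Q.root (ofIdx Q i • j)) := by
  classical
  -- `f` sees only the coefficients away from `i`, which the reflection in `i` does not change.
  obtain ⟨f, hf⟩ := exists_dual_apply_eq (Q.linearIndepOn_root_baseOf' l hl)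
    fun k ↦ if k = i then 0 else 1
  have hf0 : ∀ y ∈ Q.root '' simples Q l, 0 ≤ f y := by
    rintro _ ⟨k, hk, rfl⟩
    rw [hf k hk]
    split_ifs <;> simp
  have hfj : 0 < f (Q.root j) := by
    refine (nonneg_of_mem_closure hf0 (root_mem_closure_simples hj)).lt_of_ne' fun h ↦ hij ?_
    refine Submodule.span_mono ?_
      (mem_span_of_mem_closure_of_apply_eq_zero hf0 (root_mem_closure_simples hj) h)
    rintro _ ⟨⟨k, hk, rfl⟩, hk0⟩
    rw [SetLike.mem_coe, LinearMap.mem_ker, hf k hk] at hk0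
    simpa using hk0
  by_contra hneg
  obtain ⟨k, hk⟩ := Q.neg_root_mem (ofIdx Q i • j)
  have hlk : 0 < l (Q.root k) := by
    rw [hk, map_neg, neg_pos]
    exact (not_lt.1 hneg).lt_of_ne (hl _)
  have hfk := nonneg_of_mem_closure hf0 (root_mem_closure_simples hlk)
  rw [hk, root_smul, ofIdx_smul, map_neg, map_sub, map_smul, hf i hi, if_pos rfl, smul_zero,
    sub_zero, neg_nonneg] at hfk
  exact hfk.not_gt hfj

theorem exists_mem_simples_pairing_pos (hj : 0 < l (Q.root j)) :
    ∃ i ∈ simples Q l, 0 < Q.pairing j i := by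
  by_contra! h
  have hsymm {i : ι} : 0 < Q.pairing i j ↔ 0 < Q.pairing j i := by
    rw [← Q.algebraMap_pairingIn ℤ, ← Q.algebraMap_pairingIn ℤ]
    simpa using Q.zero_lt_pairingIn_iff' (S := ℤ) (i := i) (j := j)
  have hneg := nonneg_of_mem_closure (f := -Q.coroot' j) (s := Q.root '' simples Q l) (by
    rintro _ ⟨i, hi, rfl⟩
    rw [LinearMap.neg_apply, Q.root_coroot'_eq_pairing, neg_nonneg, ← not_lt, hsymm, not_lt]
    exact h i hi) (root_mem_closure_simples hj)
  rw [LinearMap.neg_apply, Q.root_coroot'_eq_pairing, Q.pairing_same] at hneg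
  norm_num at hneg

theorem ofIdx_mem_closure_simples_of_pos (hl : ∀ i, l (Q.root i) ≠ 0) (hj : 0 < l (Q.root j)) :
    ofIdx Q j ∈ Subgroup.closure (ofIdx Q '' simples Q l) := by
  induction j using (Finite.wellFounded_of_trans_of_irrefl
    (InvImage (· < ·) fun j ↦ l (Q.root j))).induction with
  | _ j ih
  by_cases hspan : ∃ i ∈ simples Q l, Q.root j ∈ Submodule.span ℝ {Q.root i}
  · obtain ⟨i, hi, hji⟩ := hspan
    exact Subgroup.subset_closure ⟨i, hi, (ofIdx_eq_of_root_mem_span hji).symm⟩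
  push Not at hspan
  obtain ⟨i, hi, hpos⟩ := exists_mem_simples_pairing_pos hj
  have hlt : l (Q.root (ofIdx Q i • j)) < l (Q.root j) := by
    rw [root_smul, ofIdx_smul, Q.root_coroot'_eq_pairing, map_sub, map_smul, sub_lt_self_iff]
    exact mul_pos hpos (pos_of_mem_simples hi)
  have hmem := Subgroup.subset_closure (Set.mem_image_of_mem (ofIdx Q) hi)
  have hconj := conj_ofIdx Q (ofIdx Q i)⁻¹ (ofIdx Q i • j)
  rw [inv_smul_smul, inv_inv] at hconj
  rw [← hconj]
  exact mul_mem (mul_mem (inv_mem hmem) (ih _ hlt (pos_ofIdx_smul hl hi hj (hspan i hi)))) hmem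

theorem closure_image_simples (hl : ∀ i, l (Q.root i) ≠ 0) :
    Subgroup.closure (ofIdx Q '' simples Q l) = ⊤ := by
  rw [eq_top_iff, ← closure_range_ofIdx, Subgroup.closure_le]
  rintro _ ⟨j, rfl⟩
  rcases (hl j).lt_or_gt with hneg | hpos
  · obtain ⟨k, hk⟩ := Q.neg_root_mem j
    rw [← ofIdx_eq_of_root_mem_span (i := j) (j := k) (Submodule.mem_span_singleton.2
      ⟨-1, by rw [hk, neg_one_smul]⟩)]
    exact ofIdx_mem_closure_simples_of_pos hl (by rwa [hk, map_neg, neg_pos])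
  · exact ofIdx_mem_closure_simples_of_pos hl hpos

theorem exists_list_prod_eq (hl : ∀ i, l (Q.root i) ≠ 0) (w : Q.weylGroup) :
    ∃ m : List ι, (∀ j ∈ m, j ∈ simples Q l) ∧ (m.map (ofIdx Q)).prod = w := by
  have hw : w ∈ Subgroup.closure (ofIdx Q '' simples Q l) :=
    closure_image_simples hl ▸ Subgroup.mem_top w
  induction hw using Subgroup.closure_induction'' with
  | one => exact ⟨[], by simp⟩
  | mem w hw | inv_mem w hw =>
    obtain ⟨i, hi, rfl⟩ := hw
    exact ⟨[i], by simpa using hi, by simp [ofIdx_inv]⟩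
  | mul u w _ _ hu hw =>
    obtain ⟨m, hm, rfl⟩ := hu
    obtain ⟨n, hn, rfl⟩ := hw
    exact ⟨m ++ n, fun j hj ↦ (List.mem_append.1 hj).elim (hm j) (hn j), by simp⟩

theorem exists_shorter_list_of_neg (hl : ∀ i, l (Q.root i) ≠ 0) (hi : i ∈ simples Q l)
    (m : List ι) (hm : ∀ j ∈ m, j ∈ simples Q l)
    (hneg : l (Q.root ((m.map (ofIdx Q)).prod • i)) < 0) :
    ∃ m' : List ι, (∀ j ∈ m', j ∈ simples Q l) ∧ m'.length < m.length ∧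
      (m'.map (ofIdx Q)).prod = (m.map (ofIdx Q)).prod * ofIdx Q i := by
  induction m with
  | nil =>
    rw [List.map_nil, List.prod_nil, one_smul] at hneg
    exact absurd (pos_of_mem_simples hi) hneg.not_gt
  | cons j m ih =>
    obtain ⟨hj, hm⟩ := List.forall_mem_cons.1 hm
    rw [List.map_cons, List.prod_cons] at hneg ⊢
    set w := (m.map (ofIdx Q)).prod with hw
    rcases (hl (w • i)).lt_or_gt with hneg' | hpos
    · obtain ⟨m', hm', hlen, hprod⟩ := ih hm hneg'
      exact ⟨j :: m', List.forall_mem_cons.2 ⟨hj, hm'⟩, by simpa using hlen,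
        by simp [hprod, mul_assoc]⟩
    · have hspan : Q.root (w • i) ∈ Submodule.span ℝ {Q.root j} := by
        by_contra hspan
        rw [mul_smul] at hneg
        exact hneg.not_gt (pos_ofIdx_smul hl hj hpos hspan)
      have hcomm : w * ofIdx Q i = ofIdx Q j * w := by
        rw [← ofIdx_eq_of_root_mem_span hspan, ← conj_ofIdx, inv_mul_cancel_right]
      refine ⟨m, hm, by simp, ?_⟩
      rw [mul_assoc, hcomm, ← mul_assoc, ← hw]
      nth_rewrite 1 [← ofIdx_inv j]
      rw [inv_mul_cancel, one_mul]

theorem eq_one_of_forall_pos (hl : ∀ i, l (Q.root i) ≠ 0) {w : Q.weylGroup}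
    (hw : ∀ i, 0 < l (Q.root i) → 0 < l (Q.root (w • i))) : w = 1 := by
  obtain ⟨m, ⟨hm, hprod⟩, hmin⟩ := exists_minimalFor_of_wellFoundedLT
    (fun m : List ι ↦ (∀ j ∈ m, j ∈ simples Q l) ∧ (m.map (ofIdx Q)).prod = w) List.length
    (exists_list_prod_eq hl w)
  rcases m.eq_nil_or_concat with rfl | ⟨m, i, rfl⟩
  · simpa using hprod.symm
  simp only [List.concat_eq_append, List.map_append, List.map_singleton, List.prod_append,
    List.prod_singleton, List.mem_append, List.mem_singleton] at hm hprod hmin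
  have hi := hm i (.inr rfl)
  have hneg : l (Q.root ((m.map (ofIdx Q)).prod • i)) < 0 := by
    have h := hw i (pos_of_mem_simples hi)
    rwa [← hprod, mul_smul, root_smul, root_ofIdx_smul_self, smul_neg, ← root_smul, map_neg,
      neg_pos] at h
  obtain ⟨m', hm', hlen, hprod'⟩ :=
    exists_shorter_list_of_neg hl hi m (fun j hj ↦ hm j (.inl hj)) hneg
  have hle := hmin ⟨hm', hprod'.trans hprod⟩
  rw [List.length_append, List.length_singleton] at hle
  omega

theorem map_eq_one_of_forall_pos {G : Type*} [Group G] {ρ : Representation ℝ G V} {A : Set G}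
    (hA : ∀ a ∈ A, ∃ i, ∀ x, ρ a x = Q.reflection i x) (hl : ∀ i, l (Q.root i) ≠ 0) {g : G}
    (hg : g ∈ Subgroup.closure A)
    (hpos : ∀ i, 0 < l (Q.root i) → 0 < l (ρ g (Q.root i))) : ρ g = 1 := by
  obtain ⟨w, hw⟩ : ∃ w : Q.weylGroup, ∀ x, w • x = ρ g x := by
    clear hpos
    induction hg using Subgroup.closure_induction with
    | mem a ha =>
      obtain ⟨i, hi⟩ := hA a ha
      exact ⟨ofIdx Q i, fun x ↦ (hi x).symm⟩
    | one => exact ⟨1, by simp⟩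
    | mul g h _ _ hg hh =>
      obtain ⟨u, hu⟩ := hg
      obtain ⟨w, hw⟩ := hh
      exact ⟨u * w, fun x ↦ by rw [mul_smul, hw, hu, map_mul, End.mul_apply]⟩
    | inv g _ hg =>
      obtain ⟨w, hw⟩ := hg
      refine ⟨w⁻¹, fun x ↦ ?_⟩
      rw [inv_smul_eq_iff, hw, ← End.mul_apply, ← map_mul, mul_inv_cancel, map_one, End.one_apply]
  have hw1 : w = 1 := eq_one_of_forall_pos hl fun i hi ↦ by
    rw [root_smul, hw]
    exact hpos i hi
  exact LinearMap.ext fun x ↦ by rw [← hw, hw1, one_smul, End.one_apply]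

end Simples

section Subpairing

variable {ι κ R M N : Type*} [CommRing R] [AddCommGroup M] [Module R M] [AddCommGroup N]
  [Module R N]

/-- The root pairing formed by a subfamily of the roots that is stable under its own
reflections. -/
def subpairing (P : RootPairing ι R M N) (e : κ ↪ ι)
    (h : ∀ i j, P.reflectionPerm (e i) (e j) ∈ Set.range e) : RootPairing κ R M N where
  toLinearMap := P.toLinearMap
  root := e.trans P.root
  coroot := e.trans P.coroot
  root_coroot_two i := P.root_coroot_two (e i)
  reflectionPerm i := Function.Involutive.toPerm (fun j ↦ (h i j).choose) fun j ↦ e.injective <| by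
    rw [(h i _).choose_spec, (h i j).choose_spec, P.reflectionPerm_self]
  reflectionPerm_root i j := by
    change _ = P.root (e (h i j).choose)
    rw [(h i j).choose_spec]
    exact P.reflectionPerm_root (e i) (e j)
  reflectionPerm_coroot i j := by
    change _ = P.coroot (e (h i j).choose)
    rw [(h i j).choose_spec]
    exact P.reflectionPerm_coroot (e i) (e j)

end Subpairing

section ImageStabilizer

variable {K E G : Type*} [CommRing K] [AddCommGroup E] [Module K E] [Group G] {A : Set E}

/-- The subgroup of the elements of `G` that map the set `A` onto itself. -/
def imageStabilizer (ρ : Representation K G E) (A : Set E) : Subgroup G :=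
  (MulAction.stabilizer (End K E)ˣ A).comap ρ.toHomUnits

variable {ρ : Representation K G E} {g : G}

theorem mem_imageStabilizer : g ∈ imageStabilizer ρ A ↔ ρ g '' A = A :=
  Iff.rfl

theorem mem_imageStabilizer_iff_mapsTo (hA : A.Finite) :
    g ∈ imageStabilizer ρ A ↔ Set.MapsTo (ρ g) A A := by
  refine ⟨fun h ↦ Set.mapsTo_iff_image_subset.2 (mem_imageStabilizer.1 h).subset, fun h ↦ ?_⟩
  have hinj : Function.Injective (ρ g) := (ρ.apply_bijective g).injective
  exact Set.eq_of_subset_of_ncard_le h.image_subset (Set.ncard_image_of_injective A hinj).ge hA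

end ImageStabilizer

section Semidirect

variable {κ E E' G : Type*} [AddCommGroup E] [Module ℝ E] [AddCommGroup E'] [Module ℝ E']
  [FiniteDimensional ℝ E] [Group G] [Finite G] {ρ : Representation ℝ G E} {R : RootPairing κ ℝ E E'}
  {r : κ → G}

theorem conj_eq_of_apply_root_eq (hρ : Function.Injective ρ)
    (hr : ∀ i x, ρ (r i) x = R.reflection i x) {g : G} {i j : κ}
    (h : ρ g (R.root i) = R.root j) : g * r i * g⁻¹ = r j := by
  obtain ⟨B, -, hpos, hB⟩ := exists_isSymm_pos_isOrthogonal ρ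
  have hconj (y : E) :
      ρ (g * r i * g⁻¹) y = y - R.coroot' i (ρ g⁻¹ y) • R.root j := by
    rw [map_mul, map_mul, End.mul_apply, End.mul_apply, hr, R.reflection_apply, map_sub, map_smul,
      ρ.self_inv_apply, h]
  have hconj_root : ρ (g * r i * g⁻¹) (R.root j) = -R.root j := by
    rw [← h, map_mul, map_mul, End.mul_apply, End.mul_apply, ρ.inv_self_apply, hr,
      R.reflection_apply_self, map_neg]
  have hr_root : ρ (r j) (R.root j) = -R.root j := by rw [hr, R.reflection_apply_self]
  refine hρ (LinearMap.ext fun y ↦ ?_)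
  have hy : ρ (r j) y = y - R.coroot' j y • R.root j := by rw [hr, R.reflection_apply]
  rw [hconj, hy, mul_right_cancel₀ (hpos _ (R.ne_zero j)).ne' <|
    (mul_apply_self_eq_two_mul_of_isOrthogonal (hB _) hconj_root (hconj y)).trans
      (mul_apply_self_eq_two_mul_of_isOrthogonal (hB _) hr_root hy).symm]

variable (hρ : Function.Injective ρ) (hr : ∀ i x, ρ (r i) x = R.reflection i x)
  (hperm : ∀ g i, ρ g (R.root i) ∈ Set.range R.root)

include hρ hr hperm

theorem normal_closure_range : (Subgroup.closure (Set.range r)).Normal := by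
  have hconj : Group.conjugatesOfSet (Set.range r) ⊆ Set.range r := fun g hg ↦ by
    obtain ⟨_, ⟨i, rfl⟩, h⟩ := Group.mem_conjugatesOfSet_iff.1 hg
    obtain ⟨g, rfl⟩ := isConj_iff.1 h
    obtain ⟨j, hj⟩ := hperm g i
    exact ⟨j, (conj_eq_of_apply_root_eq hρ hr hj.symm).symm⟩
  rw [Group.subset_conjugatesOfSet.antisymm hconj]
  exact Subgroup.normalClosure_normal

theorem isComplement'_imageStabilizer [Finite κ] [R.IsCrystallographic] {l : Dual ℝ E}
    (hl : ∀ i, l (R.root i) ≠ 0) :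
    (Subgroup.closure (Set.range r)).IsComplement'
      (imageStabilizer ρ {a ∈ Set.range R.root | 0 < l a}) := by
  have hmem {g : G} : g ∈ imageStabilizer ρ {a ∈ Set.range R.root | 0 < l a} ↔
      ∀ i, 0 < l (R.root i) → 0 < l (ρ g (R.root i)) := by
    rw [mem_imageStabilizer_iff_mapsTo ((Set.finite_range R.root).subset fun _ h ↦ h.1)]
    refine ⟨fun h i hi ↦ (h ⟨⟨i, rfl⟩, hi⟩).2, fun h ↦ ?_⟩
    rintro _ ⟨⟨i, rfl⟩, hi⟩
    exact ⟨hperm g i, h i hi⟩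
  refine Subgroup.isComplement'_of_disjoint_and_mul_eq_univ ?_ (Set.eq_univ_of_forall fun g ↦ ?_)
  · rw [Subgroup.disjoint_def]
    refine fun {g} hg hg' ↦ hρ ?_
    rw [map_one]
    refine map_eq_one_of_forall_pos ?_ hl hg (hmem.1 hg')
    rintro _ ⟨i, rfl⟩
    exact ⟨i, hr i⟩
  · obtain ⟨h, hh, hpos⟩ := exists_mem_forall_nonneg ρ (Subgroup.closure (Set.range r))
      (Set.range R.root) (by
        rintro _ ⟨i, rfl⟩
        exact ⟨r i, Subgroup.subset_closure ⟨i, rfl⟩, R.coroot' i, R.root_coroot_two i,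
          fun x ↦ by rw [hr, R.reflection_apply]⟩) l (l ∘ₗ ρ g⁻¹)
    refine ⟨h, hh, (g⁻¹ * h)⁻¹, inv_mem (hmem.2 fun i hi ↦ ?_), by simp⟩
    obtain ⟨j, hj⟩ := hperm (g⁻¹ * h) i
    rw [← hj]
    refine lt_of_le_of_ne ?_ (hl j).symm
    rw [hj, map_mul, End.mul_apply]
    exact hpos _ ⟨i, rfl⟩ hi

end Semidirect

section Reflective

variable {K E : Type*} [Field K] [AddCommGroup E] [Module K E]

theorem isReflective_of_apply_self_ne_zero {B : E →ₗ[K] E →ₗ[K] K} {x : E} (hx : B x x ≠ 0) :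
    B.IsReflective x :=
  ⟨.of_ne_zero hx, fun _ ↦ hx.isUnit.dvd⟩

theorem isCrystallographic_of_reflection_sub_mem [CharZero K] {κ E' : Type*} [AddCommGroup E']
    [Module K E'] {R : RootPairing κ K E E'} (h : ∀ i j, R.reflection i (R.root j) - R.root j ∈
      AddSubgroup.zmultiples (R.root i)) : R.IsCrystallographic where
  exists_value i j := by
    obtain ⟨n, hn⟩ := h j i
    refine ⟨-n, smul_left_injective K (R.ne_zero j) ?_⟩
    simp only [R.reflection_apply_root, sub_sub_cancel_left, ← Int.cast_smul_eq_zsmul K] at hn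
    simpa [neg_eq_iff_eq_neg] using hn

end Reflective

section ReflectionRootPairing

variable {K E G : Type*} [Field K] [LinearOrder K] [IsStrictOrderedRing K]
  [AddCommGroup E] [Module K E]

theorem exists_rootPairing_of_reflections [FiniteDimensional K E] [Group G] [Finite G]
    {A : Set E} (ρ : Representation K G E) (r : A → G) (h0 : ∀ a ∈ A, a ≠ 0)
    (hperm : ∀ g, Set.MapsTo (ρ g) A A) (hneg : ∀ a, ρ (r a) a = -a)
    (hr : ∀ a x, ∃ c : K, ρ (r a) x = x - c • (a : E)) :
    ∃ R : RootPairing A K E (Dual K E), (∀ x f, R.toLinearMap x f = f x) ∧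
      (∀ a, R.root a = a) ∧ ∀ a x, R.reflection a x = ρ (r a) x := by
  obtain ⟨B, hsymm, hpos, hB⟩ := exists_isSymm_pos_isOrthogonal ρ
  let Q := RootPairing.ofBilinear B (nondegenerate_of_pos hpos) hsymm (.of_ne_zero two_ne_zero)
  have ha (a : A) : B.IsReflective a :=
    isReflective_of_apply_self_ne_zero (hpos _ (h0 a a.2)).ne'
  have hreflection (a : A) (x : E) : Q.reflection ⟨a, ha a⟩ x = ρ (r a) x := by
    obtain ⟨c, hc⟩ := hr a x
    exact (eq_reflection_of_isOrthogonal hsymm (hB _) (ha a) (hneg a) hc).symm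
  refine ⟨subpairing Q ⟨fun a ↦ ⟨a, ha a⟩, fun a b h ↦ Subtype.ext (Subtype.mk.inj h)⟩
    fun a b ↦ ⟨⟨ρ (r a) b, hperm _ b.2⟩, Subtype.ext (hreflection a b).symm⟩,
    fun x f ↦ rfl, fun a ↦ rfl, hreflection⟩

end ReflectionRootPairing

section Positivity

variable {ι V V' : Type*} [AddCommGroup V] [Module ℝ V] [AddCommGroup V'] [Module ℝ V']
  {P : RootPairing ι ℝ V V'} (Δ : SimpleRoots P) {θ : Set ι} {i j : ι}

theorem exists_dual_isPos_iff (hθ : θ ⊆ Δ.support) :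
    ∃ l : Dual ℝ V, leviSpan P θ ≤ LinearMap.ker l ∧ ∀ i, P.root i ∉ leviSpan P θ →
      l (P.root i) ≠ 0 ∧ (Δ.IsPos i ↔ 0 < l (P.root i)) := by
  classical
  obtain ⟨l, hl⟩ := exists_dual_apply_eq Δ.linearIndepOn_root fun i ↦ if i ∈ θ then 0 else 1
  have hl0 : ∀ y ∈ P.root '' Δ.support, 0 ≤ l y := by
    rintro _ ⟨i, hi, rfl⟩
    rw [hl i hi]
    split_ifs <;> simp
  have hker : P.root '' Δ.support ∩ LinearMap.ker l ⊆ P.root '' θ := by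
    rintro _ ⟨⟨i, hi, rfl⟩, h⟩
    rw [SetLike.mem_coe, LinearMap.mem_ker, hl i hi] at h
    exact ⟨i, by simpa using h, rfl⟩
  have hpos {x : V} (hx : x ∈ AddSubmonoid.closure (P.root '' Δ.support))
      (hxθ : x ∉ leviSpan P θ) : 0 < l x :=
    (nonneg_of_mem_closure hl0 hx).lt_of_ne' fun h ↦
      hxθ (Submodule.span_mono hker (mem_span_of_mem_closure_of_apply_eq_zero hl0 hx h))
  refine ⟨l, Submodule.span_le.2 ?_, fun i hi ↦ ?_⟩
  · rintro _ ⟨i, hi, rfl⟩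
    simp [hl i (hθ hi), hi]
  · rcases Δ.root_mem_or_neg_mem i with h | h
    · have hli := hpos h hi
      exact ⟨hli.ne', fun _ ↦ hli, fun _ ↦ h⟩
    · have hli := hpos h (by rwa [neg_mem_iff])
      rw [map_neg, neg_pos] at hli
      exact ⟨hli.ne, fun h ↦ hpos h hi, fun h ↦ absurd hli h.not_gt⟩

theorem exists_height :
    ∃ l : Dual ℝ V, ∀ i, l (P.root i) ≠ 0 ∧ (Δ.IsPos i ↔ 0 < l (P.root i)) := by
  obtain ⟨l, -, hl⟩ := exists_dual_isPos_iff Δ (Set.empty_subset _)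
  exact ⟨l, fun i ↦ hl i (by simpa [leviSpan] using P.ne_zero i)⟩

/-- A linear functional that vanishes at no root and is positive exactly at the positive roots. -/
def height : Dual ℝ V := (exists_height Δ).choose

theorem height_ne_zero (i : ι) : height Δ (P.root i) ≠ 0 := ((exists_height Δ).choose_spec i).1

theorem isPos_iff (i : ι) : Δ.IsPos i ↔ 0 < height Δ (P.root i) :=
  ((exists_height Δ).choose_spec i).2

variable {Δ}

theorem isPos_iff_of_root_eq_smul {c : ℝ} (hc : 0 < c) (h : P.root i = c • P.root j) :
    Δ.IsPos i ↔ Δ.IsPos j := by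
  rw [isPos_iff, isPos_iff, h, map_smul, smul_eq_mul, mul_pos_iff_of_pos_left hc]

theorem isPos_iff_not_isPos_of_root_eq_neg (h : P.root i = -P.root j) :
    Δ.IsPos i ↔ ¬ Δ.IsPos j := by
  rw [isPos_iff, isPos_iff, h, map_neg, neg_pos, not_lt]
  exact (height_ne_zero Δ j).le_iff_lt.symm

theorem isPos_of_mem (hi : i ∈ Δ.support) : Δ.IsPos i :=
  AddSubmonoid.subset_closure ⟨i, hi, rfl⟩

variable (Δ) in
theorem exists_relHeight (hθ : θ ⊆ Δ.support) :
    ∃ l : Dual ℝ (RelSpace P θ), ∀ i, P.root i ∉ leviSpan P θ →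
      l ((leviSpan P θ).mkQ (P.root i)) ≠ 0 ∧
        (Δ.IsPos i ↔ 0 < l ((leviSpan P θ).mkQ (P.root i))) := by
  obtain ⟨l, hker, hl⟩ := exists_dual_isPos_iff Δ hθ
  exact ⟨(leviSpan P θ).liftQ l hker, hl⟩

variable (Δ) in
/-- A linear functional on `𝔞_M^*` that vanishes at no relative root and is positive exactly at the
positive relative roots. -/
def relHeight (hθ : θ ⊆ Δ.support) : Dual ℝ (RelSpace P θ) := (exists_relHeight Δ hθ).choose

theorem isPos_iff_relHeight (hθ : θ ⊆ Δ.support) (hi : P.root i ∉ leviSpan P θ) :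
    Δ.IsPos i ↔ 0 < relHeight Δ hθ ((leviSpan P θ).mkQ (P.root i)) :=
  ((exists_relHeight Δ hθ).choose_spec i hi).2

theorem mkQ_eq_zero_iff {x : V} : (leviSpan P θ).mkQ x = 0 ↔ x ∈ leviSpan P θ :=
  Submodule.Quotient.mk_eq_zero _

theorem mkQ_ne_zero_iff {x : V} : (leviSpan P θ).mkQ x ≠ 0 ↔ x ∉ leviSpan P θ :=
  mkQ_eq_zero_iff.not

variable {β : RelSpace P θ}

theorem relHeight_ne_zero (hθ : θ ⊆ Δ.support) (hβ : β ∈ relRoots P θ) :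
    relHeight Δ hθ β ≠ 0 := by
  obtain ⟨h0, i, rfl⟩ := hβ
  exact ((exists_relHeight Δ hθ).choose_spec i (mkQ_ne_zero_iff.1 h0)).1

theorem isRelPos_iff (hθ : θ ⊆ Δ.support) (hβ : β ∈ relRoots P θ) :
    IsRelPos Δ θ β ↔ 0 < relHeight Δ hθ β := by
  obtain ⟨h0, i, rfl⟩ := hβ
  constructor
  · rintro ⟨-, j, hj, hji⟩
    rw [← hji] at h0 ⊢
    exact (isPos_iff_relHeight hθ (mkQ_ne_zero_iff.1 h0)).1 hj
  · exact fun h ↦ ⟨h0, i, (isPos_iff_relHeight hθ (mkQ_ne_zero_iff.1 h0)).2 h, rfl⟩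

theorem isRelPos_mkQ_iff (hθ : θ ⊆ Δ.support) (hi : P.root i ∉ leviSpan P θ) :
    IsRelPos Δ θ ((leviSpan P θ).mkQ (P.root i)) ↔ Δ.IsPos i := by
  rw [isRelPos_iff hθ ⟨mkQ_ne_zero_iff.2 hi, i, rfl⟩, isPos_iff_relHeight hθ hi]

theorem neg_mem_relRoots (h : β ∈ relRoots P θ) : -β ∈ relRoots P θ := by
  obtain ⟨h0, i, rfl⟩ := h
  obtain ⟨j, hj⟩ := P.neg_root_mem i
  exact ⟨neg_ne_zero.2 h0, j, by rw [hj, map_neg]⟩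

theorem isRelPos_neg_iff (hθ : θ ⊆ Δ.support) (hβ : β ∈ relRoots P θ) :
    IsRelPos Δ θ (-β) ↔ ¬ IsRelPos Δ θ β := by
  rw [isRelPos_iff hθ hβ, isRelPos_iff hθ (neg_mem_relRoots hβ), map_neg, neg_pos, not_lt]
  exact (relHeight_ne_zero hθ hβ).le_iff_lt.symm

end Positivity

section LeviWeyl

open RootPairing.weylGroup (ofIdx)

variable {ι V V' : Type*} [AddCommGroup V] [Module ℝ V] [AddCommGroup V'] [Module ℝ V']
  {P : RootPairing ι ℝ V V'} {S T : Submodule ℝ V} {u v : P.weylGroup} {i : ι}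

variable (P) in
/-- The root pairing formed by the roots of a semistandard Levi subgroup. -/
def leviPairing (S : Submodule ℝ V) : RootPairing (leviRoots P S) ℝ V V' :=
  subpairing P (Function.Embedding.subtype _) fun i j ↦ by
    refine ⟨⟨P.reflectionPerm i j, ?_⟩, rfl⟩
    change P.root _ ∈ S
    rw [P.root_reflectionPerm, P.reflection_apply]
    exact sub_mem j.2 (S.smul_mem _ i.2)

instance [P.IsCrystallographic] : (leviPairing P S).IsCrystallographic where
  exists_value i j := P.exists_value i j

theorem leviWeyl_mono (h : S ≤ T) : leviWeyl P S ≤ leviWeyl P T :=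
  Subgroup.closure_mono (Set.image_mono fun _ hi ↦ h hi)

theorem smul_mem_leviRoots_iff (hu : u ∈ leviWeyl P S) :
    u • i ∈ leviRoots P S ↔ i ∈ leviRoots P S := by
  have h := smul_sub_mem hu (P.root i)
  rw [← root_smul] at h
  exact ⟨fun hi ↦ (S.sub_mem_iff_right hi).1 h, fun hi ↦ (S.sub_mem_iff_left hi).1 h⟩

theorem finiteDimensional_of_rootPairing (P : RootPairing ι ℝ V V') : FiniteDimensional ℝ V :=
  have : IsReflexive ℝ V := .of_isPerfPair P.toLinearMap
  inferInstance

variable (P) in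
theorem exists_root_eq_smul_forall_ne [P.IsCrystallographic] (i : ι) :
    ∃ j, ∃ c : ℝ, 0 < c ∧ P.root i = c • P.root j ∧ ∀ k, P.root j ≠ (2 : ℝ) • P.root k := by
  by_cases h : ∃ j, P.root i = (2 : ℝ) • P.root j
  · obtain ⟨j, hj⟩ := h
    refine ⟨j, 2, two_pos, hj, fun k hk ↦ ?_⟩
    obtain ⟨n, hn⟩ := P.exists_value (S := ℤ) k i
    have h2 := P.root_coroot'_eq_pairing i i
    rw [P.pairing_same, hj, hk, map_smul, map_smul, P.root_coroot'_eq_pairing, ← hn,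
      algebraMap_int_eq, Int.coe_castRingHom, smul_smul, smul_eq_mul] at h2
    norm_num at h2
    have h4 : 4 * n = 2 := by exact_mod_cast h2
    omega
  · push Not at h
    exact ⟨i, 1, one_pos, (one_smul ℝ _).symm, h⟩

variable [Finite ι]

theorem exists_mem_leviWeyl_forall_nonneg (S : Submodule ℝ V) (l μ : Dual ℝ V) :
    ∃ u ∈ leviWeyl P S, ∀ i ∈ leviRoots P S, 0 < l (P.root i) → 0 ≤ μ (P.root (u • i)) := by
  have := finiteDimensional_of_rootPairing P
  obtain ⟨u, hu, h⟩ := exists_mem_forall_nonneg P.weylGroupRootRep (leviWeyl P S)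
    (P.root '' leviRoots P S) (by
      rintro _ ⟨i, hi, rfl⟩
      exact ⟨ofIdx P i, Subgroup.subset_closure ⟨i, hi, rfl⟩, P.coroot' i, P.root_coroot_two i,
        ofIdx_smul i⟩) l μ
  refine ⟨u, hu, fun i hi hl ↦ ?_⟩
  rw [root_smul]
  exact h _ ⟨i, hi, rfl⟩ hl

theorem longest_mem (Δ : SimpleRoots P) (S : Submodule ℝ V) : longest Δ S ∈ leviWeyl P S :=
  (exists_isLongest Δ S).choose_spec.1

theorem leviLength_le_leviLength_longest (Δ : SimpleRoots P) (hu : u ∈ leviWeyl P S) :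
    leviLength Δ S u ≤ leviLength Δ S (longest Δ S) :=
  (exists_isLongest Δ S).choose_spec.2 u hu

theorem exists_mem_leviWeyl_forall_not_isPos (Δ : SimpleRoots P) (S : Submodule ℝ V) :
    ∃ u ∈ leviWeyl P S, ∀ i ∈ leviRoots P S, Δ.IsPos i → ¬ Δ.IsPos (u • i) := by
  obtain ⟨u, hu, h⟩ := exists_mem_leviWeyl_forall_nonneg (P := P) S (height Δ) (-height Δ)
  refine ⟨u, hu, fun i hi hpos hneg ↦ ?_⟩
  rw [isPos_iff] at hpos hneg
  exact (h i hi hpos).not_gt (neg_lt_zero.2 hneg)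

theorem not_isPos_longest_smul_of_forall_ne {Δ : SimpleRoots P} (hi : i ∈ leviRoots P S)
    (hred : ∀ j, P.root i ≠ (2 : ℝ) • P.root j) (hpos : Δ.IsPos i) :
    ¬ Δ.IsPos (longest Δ S • i) := by
  obtain ⟨u, hu, hneg⟩ := exists_mem_leviWeyl_forall_not_isPos Δ S
  have hsub : {i ∈ leviRoots P S | (∀ j, P.root i ≠ (2 : ℝ) • P.root j) ∧ Δ.IsPos i ∧
        ¬ Δ.IsPos (longest Δ S • i)} ⊆
      {i ∈ leviRoots P S | (∀ j, P.root i ≠ (2 : ℝ) • P.root j) ∧ Δ.IsPos i ∧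
        ¬ Δ.IsPos (u • i)} :=
    fun i ⟨hi, hred, hpos, _⟩ ↦ ⟨hi, hred, hpos, hneg i hi hpos⟩
  have hmem : i ∈ {i ∈ leviRoots P S | (∀ j, P.root i ≠ (2 : ℝ) • P.root j) ∧ Δ.IsPos i ∧
      ¬ Δ.IsPos (longest Δ S • i)} := by
    rw [Set.eq_of_subset_of_ncard_le hsub (leviLength_le_leviLength_longest Δ hu)]
    exact ⟨hi, hred, hpos, hneg i hi hpos⟩
  exact hmem.2.2.2

variable [P.IsCrystallographic] {Δ : SimpleRoots P}

theorem eq_of_forall_isPos_smul (hu : u ∈ leviWeyl P S) (hv : v ∈ leviWeyl P S)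
    (h : ∀ i ∈ leviRoots P S, Δ.IsPos (u • i) → Δ.IsPos (v • i)) : u = v := by
  suffices v * u⁻¹ = 1 from (mul_inv_eq_one.1 this).symm
  refine Subtype.ext (RootPairing.Equiv.weightHom_injective P (LinearEquiv.ext fun x ↦ ?_))
  refine LinearMap.congr_fun (map_eq_one_of_forall_pos (Q := leviPairing P S) (l := height Δ)
    (ρ := P.weylGroupRootRep) ?_ (fun i ↦ height_ne_zero Δ i) (mul_mem hv (inv_mem hu))
    fun i hi ↦ ?_) x
  · rintro _ ⟨i, hi, rfl⟩
    exact ⟨⟨i, hi⟩, fun x ↦ rfl⟩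
  · have hi' := h (u⁻¹ • i) ((smul_mem_leviRoots_iff (inv_mem hu)).2 i.2)
    rw [smul_inv_smul, isPos_iff, isPos_iff, ← mul_smul, root_smul] at hi'
    exact hi' hi

theorem not_isPos_longest_smul (hi : i ∈ leviRoots P S) (hpos : Δ.IsPos i) :
    ¬ Δ.IsPos (longest Δ S • i) := by
  obtain ⟨j, c, hc, hij, hj⟩ := exists_root_eq_smul_forall_ne P i
  have hjS : j ∈ leviRoots P S := (S.smul_mem_iff hc.ne').1 (hij ▸ hi)
  have hsmul : P.root (longest Δ S • i) = c • P.root (longest Δ S • j) := by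
    rw [root_smul, root_smul, hij, smul_comm]
  rw [isPos_iff_of_root_eq_smul hc hsmul]
  exact not_isPos_longest_smul_of_forall_ne hjS hj ((isPos_iff_of_root_eq_smul hc hij).1 hpos)

theorem isPos_longest_smul_iff (hi : i ∈ leviRoots P S) :
    Δ.IsPos (longest Δ S • i) ↔ ¬ Δ.IsPos i := by
  refine ⟨fun h hpos ↦ not_isPos_longest_smul hi hpos h, fun hneg ↦ ?_⟩
  obtain ⟨j, hj⟩ := P.neg_root_mem i
  have hjS : j ∈ leviRoots P S := by
    rw [leviRoots, Set.mem_ofPred_eq, hj, neg_mem_iff]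
    exact hi
  have hsmul : P.root (longest Δ S • i) = -P.root (longest Δ S • j) := by
    rw [root_smul, root_smul, hj, smul_neg, neg_neg]
  rw [isPos_iff_not_isPos_of_root_eq_neg hsmul]
  exact not_isPos_longest_smul hjS ((isPos_iff_not_isPos_of_root_eq_neg hj).2 hneg)

end LeviWeyl

section LeviStabilizer

open RootPairing.weylGroup (ofIdx)

variable {ι V V' : Type*} [AddCommGroup V] [Module ℝ V] [AddCommGroup V'] [Module ℝ V']
  {P : RootPairing ι ℝ V V'} {S T : Submodule ℝ V} {θ : Set ι} {u w : P.weylGroup} {i : ι}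

theorem leviWeyl_le_leviStabilizer : leviWeyl P (leviSpan P θ) ≤ leviStabilizer P θ :=
  fun _ hu ↦ MulAction.mem_stabilizer_set.2 fun _ ↦ smul_mem_leviRoots_iff hu

theorem mkQ_root_smul_of_mem (hu : u ∈ leviWeyl P (leviSpan P θ)) (i : ι) :
    (leviSpan P θ).mkQ (P.root (u • i)) = (leviSpan P θ).mkQ (P.root i) := by
  rw [root_smul]
  exact (Submodule.Quotient.eq _).2 (smul_sub_mem hu _)

theorem stabilizerRep_mkQ_root (w : leviStabilizer P θ) (i : ι) :
    stabilizerRep P θ w ((leviSpan P θ).mkQ (P.root i)) =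
      (leviSpan P θ).mkQ (P.root ((w : P.weylGroup) • i)) := by
  rw [root_smul]
  rfl

theorem conj_mem_leviWeyl (hw : ∀ i ∈ leviRoots P S, w • i ∈ leviRoots P T)
    (hu : u ∈ leviWeyl P S) : w * u * w⁻¹ ∈ leviWeyl P T := by
  have hle : leviWeyl P S ≤ (leviWeyl P T).comap (MulAut.conj w).toMonoidHom := by
    refine (Subgroup.closure_le _).2 ?_
    rintro _ ⟨i, hi, rfl⟩
    exact Subgroup.subset_closure ⟨w • i, hw i hi, (conj_ofIdx P w i).symm⟩
  exact hle hu

theorem smul_root_sub_mem [P.IsCrystallographic] {A : AddSubgroup V}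
    (hA : ∀ i ∈ leviRoots P S, P.root i ∈ A) (hu : u ∈ leviWeyl P S) (i : ι) :
    u • P.root i - P.root i ∈ A := by
  induction hu using Subgroup.closure_induction generalizing i with
  | one => simp
  | mem u hu =>
    obtain ⟨j, hj, rfl⟩ := hu
    obtain ⟨m, hm⟩ := P.exists_value (S := ℤ) i j
    rw [ofIdx_smul, sub_sub_cancel_left, neg_mem_iff, P.root_coroot'_eq_pairing, ← hm,
      algebraMap_int_eq, Int.coe_castRingHom, Int.cast_smul_eq_zsmul]
    exact zsmul_mem (hA j hj) m
  | inv u _ hu =>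
    have h := neg_mem (hu (u⁻¹ • i))
    rwa [root_smul, smul_inv_smul, neg_sub] at h
  | mul u v _ _ hu hv =>
    have h := add_mem (hu (v • i)) (hv i)
    rwa [root_smul, sub_add_sub_cancel, smul_smul] at h

theorem exists_mul_isPos_smul_iff [Finite ι] (Δ : SimpleRoots P) (S : Submodule ℝ V)
    (w : P.weylGroup) :
    ∃ u ∈ leviWeyl P S, ∀ i ∈ leviRoots P S, Δ.IsPos ((w * u) • i) ↔ Δ.IsPos i := by
  obtain ⟨u, hu, h⟩ := exists_mem_leviWeyl_forall_nonneg (P := P) S (height Δ)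
    (height Δ ∘ₗ P.weylGroupRootRep w)
  have hpos (i) (hi : i ∈ leviRoots P S) (hi' : Δ.IsPos i) : Δ.IsPos ((w * u) • i) := by
    rw [isPos_iff] at hi' ⊢
    refine lt_of_le_of_ne' ?_ (height_ne_zero Δ _)
    rw [mul_smul, root_smul]
    exact h i hi hi'
  refine ⟨u, hu, fun i hi ↦ ⟨fun h ↦ ?_, hpos i hi⟩⟩
  obtain ⟨j, hj⟩ := P.neg_root_mem i
  have hjS : j ∈ leviRoots P S := by
    rw [leviRoots, Set.mem_ofPred_eq, hj, neg_mem_iff]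
    exact hi
  by_contra hneg
  have hsmul : P.root ((w * u) • j) = -P.root ((w * u) • i) := by
    rw [root_smul, root_smul, hj, smul_neg]
  exact (isPos_iff_not_isPos_of_root_eq_neg hsmul).1
    (hpos j hjS ((isPos_iff_not_isPos_of_root_eq_neg hj).2 hneg)) h

end LeviStabilizer

section RelRoots

variable {ι V V' : Type*} [AddCommGroup V] [Module ℝ V] [AddCommGroup V'] [Module ℝ V']
  {P : RootPairing ι ℝ V V'} {θ : Set ι} {α β γ : RelSpace P θ}

theorem leviSpan_le_corankOneSpan (β : RelSpace P θ) : leviSpan P θ ≤ corankOneSpan β := by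
  rw [corankOneSpan]
  exact (leviSpan P θ).le_comap_mkQ _

theorem mem_corankOneSpan {x : V} :
    x ∈ corankOneSpan β ↔ ∃ c : ℝ, c • β = (leviSpan P θ).mkQ x := by
  rw [corankOneSpan, Submodule.mem_comap, Submodule.mem_span_singleton]

theorem eq_of_eq_nsmul (hβ : β ∈ reducedRelRoots P θ) (hγ : γ ∈ relRoots P θ) {n : ℕ}
    (h : β = n • γ) : β = γ := by
  have hn : n < 2 := lt_of_not_ge fun hn ↦ hβ.2 γ hγ n hn h
  interval_cases n
  · exact absurd (h.trans (zero_smul ℕ γ)) hβ.1.1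
  · rwa [one_smul] at h

theorem eq_or_eq_neg_of_mem_zmultiples (hβ : β ∈ reducedRelRoots P θ) (hγ : γ ∈ relRoots P θ)
    (h : β ∈ AddSubgroup.zmultiples γ) : β = γ ∨ β = -γ := by
  obtain ⟨m, rfl⟩ := AddSubgroup.mem_zmultiples_iff.1 h
  obtain ⟨n, rfl | rfl⟩ := m.eq_nat_or_neg
  · exact .inl (eq_of_eq_nsmul hβ hγ (natCast_zsmul γ n))
  · exact .inr (eq_of_eq_nsmul hβ (neg_mem_relRoots hγ) (by rw [neg_smul, natCast_zsmul, smul_neg]))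

theorem stabilizerRep_mem_relRoots (w : leviStabilizer P θ) (hβ : β ∈ relRoots P θ) :
    stabilizerRep P θ w β ∈ relRoots P θ := by
  obtain ⟨h0, i, rfl⟩ := hβ
  rw [stabilizerRep_mkQ_root]
  refine ⟨?_, _, rfl⟩
  rw [mkQ_ne_zero_iff, mem_leviStabilizer w.2]
  exact mkQ_ne_zero_iff.1 h0

theorem stabilizerRep_mem_reducedRelRoots (w : leviStabilizer P θ)
    (hβ : β ∈ reducedRelRoots P θ) : stabilizerRep P θ w β ∈ reducedRelRoots P θ := by
  refine ⟨stabilizerRep_mem_relRoots w hβ.1, fun γ hγ n hn h ↦ ?_⟩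
  refine hβ.2 _ (stabilizerRep_mem_relRoots w⁻¹ hγ) n hn ?_
  rw [← map_nsmul, ← h, Representation.inv_self_apply]

theorem finite_relRoots [Finite ι] : (relRoots P θ).Finite :=
  (Set.finite_range fun i ↦ (leviSpan P θ).mkQ (P.root i)).subset fun _ h ↦ h.2

variable {Δ : SimpleRoots P} [Finite ι]

theorem leviSpan_le_span_simples {S : Submodule ℝ V} (hθ : θ ⊆ Δ.support)
    (hS : leviSpan P θ ≤ S) :
    leviSpan P θ ≤ Submodule.span ℝ ((leviPairing P S).root ''
      {j ∈ simples (leviPairing P S) (height Δ) | P.root j ∈ leviSpan P θ}) := by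
  set l := relHeight Δ hθ ∘ₗ (leviSpan P θ).mkQ
  set B := (leviPairing P S).root '' simples (leviPairing P S) (height Δ)
  have hl_pos (j) (hj : j ∈ simples (leviPairing P S) (height Δ))
      (hjM : P.root j ∉ leviSpan P θ) : 0 < l (P.root j) :=
    (isPos_iff_relHeight hθ hjM).1 <|
      (isPos_iff Δ j).2 (pos_of_mem_simples (Q := leviPairing P S) hj)
  have hl_zero {x : V} (hx : x ∈ leviSpan P θ) : l x = 0 := by
    rw [LinearMap.comp_apply, mkQ_eq_zero_iff.2 hx, map_zero]
  have hB : B ∩ LinearMap.ker l ⊆ (leviPairing P S).root ''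
      {j ∈ simples (leviPairing P S) (height Δ) | P.root j ∈ leviSpan P θ} := by
    rintro _ ⟨⟨j, hj, rfl⟩, hj0⟩
    exact ⟨j, ⟨hj, by_contra fun hjM ↦ (hl_pos j hj hjM).ne' hj0⟩, rfl⟩
  have hnonneg : ∀ y ∈ B, 0 ≤ l y := by
    rintro _ ⟨j, hj, rfl⟩
    by_cases hjM : P.root j ∈ leviSpan P θ
    · exact (hl_zero hjM).ge
    · exact (hl_pos j hj hjM).le
  conv_lhs => rw [leviSpan]
  refine Submodule.span_le.2 ?_
  rintro _ ⟨k, hk, rfl⟩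
  have hkM : P.root k ∈ leviSpan P θ := Submodule.subset_span ⟨k, hk, rfl⟩
  exact Submodule.span_mono hB (mem_span_of_mem_closure_of_apply_eq_zero hnonneg
    (root_mem_closure_simples (Q := leviPairing P S) (i := ⟨k, hS hkM⟩)
      ((isPos_iff Δ k).1 (isPos_of_mem (hθ hk)))) (hl_zero hkM))

variable [P.IsCrystallographic]

theorem eq_of_mem_simples_of_notMem_leviSpan (hθ : θ ⊆ Δ.support)
    {a b : leviRoots P (corankOneSpan β)}
    (ha : a ∈ simples (leviPairing P (corankOneSpan β)) (height Δ))
    (hb : b ∈ simples (leviPairing P (corankOneSpan β)) (height Δ))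
    (haM : P.root a ∉ leviSpan P θ) (hbM : P.root b ∉ leviSpan P θ) : a = b := by
  set Q := leviPairing P (corankOneSpan β)
  set D := simples Q (height Δ)
  set D' := {j ∈ D | P.root j ∈ leviSpan P θ}
  have hD : LinearIndepOn ℝ Q.root D :=
    Q.linearIndepOn_root_baseOf' (height Δ) fun j ↦ height_ne_zero Δ j
  have hbD' : insert b D' ⊆ D := Set.insert_subset hb fun _ h ↦ h.1
  obtain ⟨c, hc⟩ := mem_corankOneSpan.1 a.2
  obtain ⟨d, hd⟩ := mem_corankOneSpan.1 b.2
  have hd0 : d ≠ 0 := fun h ↦ hbM (mkQ_eq_zero_iff.1 (by rw [← hd, h, zero_smul]))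
  have hsub : P.root a - (c / d) • P.root b ∈ leviSpan P θ := by
    rw [← mkQ_eq_zero_iff, map_sub, map_smul, ← hc, ← hd, smul_smul, div_mul_cancel₀ c hd0,
      sub_self]
  have hspan : Q.root a ∈ Submodule.span ℝ (Q.root '' insert b D') := by
    rw [Set.image_insert_eq, Submodule.mem_span_insert]
    exact ⟨c / d, _, leviSpan_le_span_simples hθ (leviSpan_le_corankOneSpan β) hsub,
      (add_sub_cancel _ _).symm⟩
  exact ((hD.mono hbD').mem_span_iff.1 hspan (hD.mono (Set.insert_subset ha hbD'))).resolve_right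
    fun h ↦ haM h.2

theorem exists_relRoot_forall_mem_zmultiples (hθ : θ ⊆ Δ.support) (hβ : β ∈ relRoots P θ) :
    ∃ γ ∈ relRoots P θ, ∀ i ∈ leviRoots P (corankOneSpan β),
      (leviSpan P θ).mkQ (P.root i) ∈ AddSubgroup.zmultiples γ := by
  set D := simples (leviPairing P (corankOneSpan β)) (height Δ) with hD
  have hmem {A : AddSubgroup (RelSpace P θ)} (hA : ∀ j ∈ D, (leviSpan P θ).mkQ (P.root j) ∈ A)
      (i) (hi : i ∈ leviRoots P (corankOneSpan β)) : (leviSpan P θ).mkQ (P.root i) ∈ A :=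
    root_mem_of_forall_simples (Q := leviPairing P (corankOneSpan β)) (l := height Δ)
      (A := A.comap (leviSpan P θ).mkQ.toAddMonoidHom) (fun j ↦ height_ne_zero Δ j) hA ⟨i, hi⟩
  obtain ⟨a, ha, haM⟩ : ∃ a ∈ D, P.root a ∉ leviSpan P θ := by
    by_contra! hall
    obtain ⟨h0, i, rfl⟩ := hβ
    exact h0 (hmem (A := ⊥) (fun j hj ↦ mkQ_eq_zero_iff.2 (hall j hj)) i
      (mem_corankOneSpan.2 ⟨1, one_smul ℝ _⟩))
  refine ⟨_, ⟨mkQ_ne_zero_iff.2 haM, a, rfl⟩, hmem fun j hj ↦ ?_⟩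
  by_cases hjM : P.root j ∈ leviSpan P θ
  · rw [mkQ_eq_zero_iff.2 hjM]
    exact zero_mem _
  · rw [eq_of_mem_simples_of_notMem_leviSpan hθ hj ha hjM haM]
    exact AddSubgroup.mem_zmultiples _

theorem mkQ_root_mem_zmultiples (hθ : θ ⊆ Δ.support) (hβ : β ∈ reducedRelRoots P θ) {i : ι}
    (hi : i ∈ leviRoots P (corankOneSpan β)) :
    (leviSpan P θ).mkQ (P.root i) ∈ AddSubgroup.zmultiples β := by
  obtain ⟨γ, hγ, hall⟩ := exists_relRoot_forall_mem_zmultiples hθ hβ.1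
  obtain ⟨j, hj⟩ := hβ.1.2
  have hβγ : β ∈ AddSubgroup.zmultiples γ :=
    hj ▸ hall j (mem_corankOneSpan.2 ⟨1, by rw [one_smul, hj]⟩)
  rcases eq_or_eq_neg_of_mem_zmultiples hβ hγ hβγ with rfl | rfl
  · exact hall i hi
  · rw [AddSubgroup.zmultiples_neg]
    exact hall i hi

theorem eq_or_eq_neg_of_eq_smul (hθ : θ ⊆ Δ.support) (hα : α ∈ reducedRelRoots P θ)
    (hβ : β ∈ reducedRelRoots P θ) {c : ℝ} (h : α = c • β) : α = β ∨ α = -β := by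
  obtain ⟨i, hi⟩ := hα.1.2
  refine eq_or_eq_neg_of_mem_zmultiples hα hβ.1 ?_
  rw [← hi]
  exact mkQ_root_mem_zmultiples hθ hβ (mem_corankOneSpan.2 ⟨c, by rw [← h, hi]⟩)

end RelRoots

section RelReflection

variable {ι V V' : Type*} [AddCommGroup V] [Module ℝ V] [AddCommGroup V'] [Module ℝ V']
  {P : RootPairing ι ℝ V V'} {Δ : SimpleRoots P} {θ : Set ι} {β : RelSpace P θ} {i : ι}

theorem isPos_smul_iff_of_mkQ_eq {j : ι} (hθ : θ ⊆ Δ.support) (hi : P.root i ∉ leviSpan P θ)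
    (h : (leviSpan P θ).mkQ (P.root j) = (leviSpan P θ).mkQ (P.root i)) :
    Δ.IsPos j ↔ Δ.IsPos i := by
  have hj : P.root j ∉ leviSpan P θ := by
    rwa [← mkQ_ne_zero_iff, h, mkQ_ne_zero_iff]
  rw [← isRelPos_mkQ_iff hθ hi, ← isRelPos_mkQ_iff hθ hj, h]

theorem exists_stabilizerRep_eq_sub_smul {w : leviStabilizer P θ}
    (hw : (w : P.weylGroup) ∈ leviWeyl P (corankOneSpan β)) (y : RelSpace P θ) :
    ∃ c : ℝ, stabilizerRep P θ w y = y - c • β := by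
  obtain ⟨x, rfl⟩ := (leviSpan P θ).mkQ_surjective y
  obtain ⟨c, hc⟩ := mem_corankOneSpan.1 (smul_sub_mem hw x)
  refine ⟨-c, ?_⟩
  rw [neg_smul, hc, map_sub, sub_neg_eq_add, add_sub_cancel]
  rfl

variable [Finite ι]

theorem relReflection_mem (Δ : SimpleRoots P) (β : RelSpace P θ) :
    relReflection Δ β ∈ leviWeyl P (corankOneSpan β) :=
  mul_mem (longest_mem Δ _) (leviWeyl_mono (leviSpan_le_corankOneSpan β) (longest_mem Δ _))

variable [P.IsCrystallographic]

theorem isPos_relReflection_smul_iff (hi : i ∈ leviRoots P (corankOneSpan β)) :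
    Δ.IsPos (relReflection Δ β • i) ↔ ¬ Δ.IsPos (longest Δ (leviSpan P θ) • i) := by
  rw [relReflection, mul_smul, isPos_longest_smul_iff]
  exact (smul_mem_leviRoots_iff
    (leviWeyl_mono (leviSpan_le_corankOneSpan β) (longest_mem Δ _))).2 hi

theorem isPos_relReflection_smul_iff_of_mem (hi : P.root i ∈ leviSpan P θ) :
    Δ.IsPos (relReflection Δ β • i) ↔ Δ.IsPos i := by
  have hiβ : i ∈ leviRoots P (corankOneSpan β) := leviSpan_le_corankOneSpan β hi
  rw [isPos_relReflection_smul_iff hiβ, isPos_longest_smul_iff (S := leviSpan P θ) hi, not_not]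

theorem isPos_relReflection_smul_iff_of_notMem (hθ : θ ⊆ Δ.support)
    (hi : i ∈ leviRoots P (corankOneSpan β)) (hiM : P.root i ∉ leviSpan P θ) :
    Δ.IsPos (relReflection Δ β • i) ↔ ¬ Δ.IsPos i := by
  rw [isPos_relReflection_smul_iff hi,
    isPos_smul_iff_of_mkQ_eq hθ hiM (mkQ_root_smul_of_mem (longest_mem Δ _) i)]

theorem stabilizerRep_relReflection (hθ : θ ⊆ Δ.support) (hβ : β ∈ relRootsZero Δ θ) :
    stabilizerRep P θ ⟨relReflection Δ β, hβ.2⟩ β = -β := by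
  obtain ⟨c, hc⟩ := exists_stabilizerRep_eq_sub_smul (w := ⟨_, hβ.2⟩) (relReflection_mem Δ β) β
  refine (eq_or_eq_neg_of_eq_smul hθ (stabilizerRep_mem_reducedRelRoots _ hβ.1) hβ.1
    (c := 1 - c) (by rw [hc, sub_smul, one_smul])).resolve_left fun h ↦ ?_
  obtain ⟨h0, i, rfl⟩ := hβ.1.1
  rw [stabilizerRep_mkQ_root] at h
  have hi := mkQ_ne_zero_iff.1 h0
  exact iff_not_self ((isPos_smul_iff_of_mkQ_eq hθ hi h).symm.trans
    (isPos_relReflection_smul_iff_of_notMem hθ (mem_corankOneSpan.2 ⟨1, one_smul ℝ _⟩) hi))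

theorem relReflection_mem_leviStabilizer (hθ : θ ⊆ Δ.support) {w : leviStabilizer P θ}
    (hw : (w : P.weylGroup) ∈ leviWeyl P (corankOneSpan β)) (hwβ : stabilizerRep P θ w β = -β) :
    relReflection Δ β ∈ leviStabilizer P θ := by
  obtain ⟨u, hu, hpos⟩ := exists_mul_isPos_smul_iff Δ (leviSpan P θ) (w : P.weylGroup)
  suffices (w : P.weylGroup) * u = relReflection Δ β from
    this ▸ mul_mem w.2 (leviWeyl_le_leviStabilizer hu)
  refine eq_of_forall_isPos_smul (Δ := Δ)
    (mul_mem hw (leviWeyl_mono (leviSpan_le_corankOneSpan β) hu)) (relReflection_mem Δ β)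
    fun i hi h ↦ ?_
  by_cases hiM : P.root i ∈ leviSpan P θ
  · rwa [isPos_relReflection_smul_iff_of_mem hiM, ← hpos i hiM]
  have hneg : (leviSpan P θ).mkQ (P.root (((w : P.weylGroup) * u) • i)) =
      -(leviSpan P θ).mkQ (P.root i) := by
    obtain ⟨c, hc⟩ := mem_corankOneSpan.1 hi
    rw [mul_smul, ← stabilizerRep_mkQ_root, mkQ_root_smul_of_mem hu, ← hc, map_smul, hwβ, smul_neg]
  have hrel := isRelPos_mkQ_iff hθ (i := ((w : P.weylGroup) * u) • i) <| by
    rw [← mkQ_ne_zero_iff, hneg, neg_ne_zero]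
    exact mkQ_ne_zero_iff.2 hiM
  rw [hneg, isRelPos_neg_iff hθ ⟨mkQ_ne_zero_iff.2 hiM, i, rfl⟩, isRelPos_mkQ_iff hθ hiM] at hrel
  rw [isPos_relReflection_smul_iff_of_notMem hθ hi hiM, hrel]
  exact h

theorem mem_leviWeyl_of_stabilizerRep_eq_one (hθ : θ ⊆ Δ.support) {w : leviStabilizer P θ}
    (hw : stabilizerRep P θ w = 1) : (w : P.weylGroup) ∈ leviWeyl P (leviSpan P θ) := by
  obtain ⟨u, hu, hpos⟩ := exists_mul_isPos_smul_iff Δ (leviSpan P θ) (w : P.weylGroup)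
  suffices (w : P.weylGroup) * u = 1 from eq_inv_of_mul_eq_one_left this ▸ inv_mem hu
  refine eq_of_forall_isPos_smul (Δ := Δ) (S := ⊤) (by simp [leviWeyl_top]) (one_mem _)
    fun i _ h ↦ ?_
  rw [one_smul]
  by_cases hiM : P.root i ∈ leviSpan P θ
  · exact (hpos i hiM).1 h
  · refine (isPos_smul_iff_of_mkQ_eq hθ hiM ?_).1 h
    rw [mul_smul, ← stabilizerRep_mkQ_root, hw, End.one_apply, mkQ_root_smul_of_mem hu]

end RelReflection

section RelWeylGroup

variable {ι V V' : Type*} [AddCommGroup V] [Module ℝ V] [AddCommGroup V'] [Module ℝ V']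
  {P : RootPairing ι ℝ V V'} [Finite ι] {Δ : SimpleRoots P} {θ : Set ι}
  (β : relRootsZero Δ θ)

theorem exists_relRep_relReflectionClass_eq_sub_smul (x : RelSpace P θ) :
    ∃ c : ℝ, relRep P θ (relReflectionClass Δ β) x = x - c • (β : RelSpace P θ) :=
  exists_stabilizerRep_eq_sub_smul (relReflection_mem Δ β.1) x

variable [P.IsCrystallographic]

theorem relRep_injective (hθ : θ ⊆ Δ.support) : Function.Injective (relRep P θ) := by
  refine (injective_iff_map_eq_one _).2 fun w hw ↦ ?_
  obtain ⟨w, rfl⟩ := QuotientGroup.mk_surjective w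
  rw [QuotientGroup.eq_one_iff, Subgroup.mem_subgroupOf]
  exact mem_leviWeyl_of_stabilizerRep_eq_one hθ hw

theorem relRep_mem_relRootsZero (hθ : θ ⊆ Δ.support) (w : RelWeylGroup P θ) {β : RelSpace P θ}
    (hβ : β ∈ relRootsZero Δ θ) : relRep P θ w β ∈ relRootsZero Δ θ := by
  obtain ⟨w, rfl⟩ := QuotientGroup.mk_surjective w
  have hmaps (i) (hi : i ∈ leviRoots P (corankOneSpan β)) :
      (w : P.weylGroup) • i ∈ leviRoots P (corankOneSpan (stabilizerRep P θ w β)) := by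
    obtain ⟨c, hc⟩ := mem_corankOneSpan.1 hi
    exact mem_corankOneSpan.2 ⟨c, by rw [← map_smul, hc, stabilizerRep_mkQ_root]⟩
  refine ⟨stabilizerRep_mem_reducedRelRoots w hβ.1, relReflection_mem_leviStabilizer hθ
    (w := w * ⟨_, hβ.2⟩ * w⁻¹) (conj_mem_leviWeyl hmaps (relReflection_mem Δ β)) ?_⟩
  change stabilizerRep P θ _ (stabilizerRep P θ w β) = -stabilizerRep P θ w β
  rw [map_mul, map_mul, End.mul_apply, End.mul_apply, Representation.inv_self_apply,
    stabilizerRep_relReflection hθ hβ, map_neg]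

theorem relRep_relReflectionClass_self (hθ : θ ⊆ Δ.support) :
    relRep P θ (relReflectionClass Δ β) β = -β :=
  stabilizerRep_relReflection hθ β.2

theorem relRep_relReflectionClass_sub_mem_zmultiples (hθ : θ ⊆ Δ.support) {γ : RelSpace P θ}
    (hγ : γ ∈ relRoots P θ) : relRep P θ (relReflectionClass Δ β) γ - γ ∈
      AddSubgroup.zmultiples (β : RelSpace P θ) := by
  obtain ⟨-, i, rfl⟩ := hγ
  exact smul_root_sub_mem
    (A := (AddSubgroup.zmultiples β.1).comap (leviSpan P θ).mkQ.toAddMonoidHom)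
    (fun j hj ↦ mkQ_root_mem_zmultiples hθ β.2.1 hj) (relReflection_mem Δ β.1) i

end RelWeylGroup

section RelRootsZero

variable {ι V V' : Type*} [AddCommGroup V] [Module ℝ V] [AddCommGroup V'] [Module ℝ V']
  {P : RootPairing ι ℝ V V'} [Finite ι] {Δ : SimpleRoots P} {θ : Set ι}

theorem finite_relRootsZero : (relRootsZero Δ θ).Finite :=
  finite_relRoots.subset fun _ hβ ↦ hβ.1.1

theorem relRootsZeroPos_eq_relHeight_pos (hθ : θ ⊆ Δ.support) :
    relRootsZeroPos Δ θ = {β ∈ relRootsZero Δ θ | 0 < relHeight Δ hθ β} :=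
  Set.ext fun _ ↦ and_congr_right fun hβ ↦ isRelPos_iff hθ hβ.1.1

variable [P.IsCrystallographic]

theorem coe_imageStabilizer_relRootsZeroPos (hθ : θ ⊆ Δ.support) :
    (imageStabilizer (relRep P θ) (relRootsZeroPos Δ θ) : Set (RelWeylGroup P θ)) =
      relWeylOne Δ θ := by
  ext w
  rw [SetLike.mem_coe,
    mem_imageStabilizer_iff_mapsTo (finite_relRootsZero.subset fun _ hβ ↦ hβ.1)]
  exact forall₂_congr fun β hβ ↦ and_iff_right (relRep_mem_relRootsZero hθ w hβ.1)

theorem exists_relRootPairing (hθ : θ ⊆ Δ.support) :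
    ∃ R : RootPairing (relRootsZero Δ θ) ℝ (RelSpace P θ) (Dual ℝ (RelSpace P θ)),
      (∀ x f, R.toLinearMap x f = f x) ∧ (∀ β, R.root β = (β : RelSpace P θ)) ∧
      R.IsCrystallographic ∧ R.IsReduced ∧
      ∀ β x, R.reflection β x = relRep P θ (relReflectionClass Δ β) x := by
  have := finiteDimensional_of_rootPairing P
  obtain ⟨R, hdual, hroot, hreflection⟩ := exists_rootPairing_of_reflections (relRep P θ)
    (relReflectionClass Δ) (fun β hβ ↦ hβ.1.1.1) (fun w β hβ ↦ relRep_mem_relRootsZero hθ w hβ)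
    (relRep_relReflectionClass_self · hθ) exists_relRep_relReflectionClass_eq_sub_smul
  refine ⟨R, hdual, hroot, isCrystallographic_of_reflection_sub_mem fun β γ ↦ ?_, ⟨fun β γ h ↦ ?_⟩,
    hreflection⟩
  · rw [hreflection, hroot, hroot]
    exact relRep_relReflectionClass_sub_mem_zmultiples β hθ γ.2.1.1
  · rw [LinearIndependent.pair_symm_iff, LinearIndependent.pair_iff' (R.ne_zero γ)] at h
    push Not at h
    obtain ⟨c, hc⟩ := h
    rw [hroot, hroot] at hc ⊢
    exact eq_or_eq_neg_of_eq_smul hθ β.2.1 γ.2.1 hc.symm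

end RelRootsZero

end RelativeWeyl

end

theorem mainTheorem2 {ι V V' : Type*} [Finite ι] [AddCommGroup V] [Module ℝ V]
    [AddCommGroup V'] [Module ℝ V'] (P : RootPairing ι ℝ V V') [P.IsCrystallographic]
    (Δ : RelativeWeyl.SimpleRoots P) (θ : Set ι) (hθ : θ ⊆ Δ.support) :
    (∃ H : Subgroup (RelativeWeyl.RelWeylGroup P θ),
      (H : Set (RelativeWeyl.RelWeylGroup P θ)) = RelativeWeyl.relWeylOne Δ θ ∧
      (∀ w, w ∈ H ↔ RelativeWeyl.relRep P θ w '' RelativeWeyl.relRootsZeroPos Δ θ =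
        RelativeWeyl.relRootsZeroPos Δ θ) ∧
      (RelativeWeyl.relWeylZero Δ θ).Normal ∧
      (RelativeWeyl.relWeylZero Δ θ).IsComplement' H) ∧
    (RelativeWeyl.relRootsZero Δ θ).Finite ∧
    ∃ R : RootPairing (RelativeWeyl.relRootsZero Δ θ) ℝ (RelativeWeyl.RelSpace P θ)
        (Module.Dual ℝ (RelativeWeyl.RelSpace P θ)),
      (∀ x f, R.toLinearMap x f = f x) ∧
      (∀ β, R.root β = (β : RelativeWeyl.RelSpace P θ)) ∧
      R.IsCrystallographic ∧ R.IsReduced ∧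
      ∀ β x, R.reflection β x =
        RelativeWeyl.relRep P θ (RelativeWeyl.relReflectionClass Δ β) x := by
  open RelativeWeyl in
  obtain ⟨R, hdual, hroot, hcryst, hred, hreflection⟩ := exists_relRootPairing hθ
  have := finiteDimensional_of_rootPairing P
  have := (finite_relRootsZero (Δ := Δ) (θ := θ)).to_subtype
  have hrange : Set.range R.root = relRootsZero Δ θ := by
    rw [funext hroot, Subtype.range_coe]
  have hinj := relRep_injective (P := P) hθ
  have hr β x := (hreflection β x).symm
  have hperm w β : relRep P θ w (R.root β) ∈ Set.range R.root := by
    rw [hrange, hroot]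
    exact relRep_mem_relRootsZero hθ w β.2
  refine ⟨⟨imageStabilizer (relRep P θ) (relRootsZeroPos Δ θ),
    coe_imageStabilizer_relRootsZeroPos hθ, fun w ↦ mem_imageStabilizer,
    normal_closure_range hinj hr hperm, ?_⟩, finite_relRootsZero,
    R, hdual, hroot, hcryst, hred, hreflection⟩
  rw [relRootsZeroPos_eq_relHeight_pos hθ, ← hrange]
  refine isComplement'_imageStabilizer hinj hr hperm fun β ↦ ?_
  rw [hroot]
  exact relHeight_ne_zero hθ β.2.1.1
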